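/- **Theorem 1.5.** For a finite connected graph $G=(V(G),E(G))$, a nonempty set $V_0\subseteq V(G)$ and an even function $U:\mathbb R\to\mathbb R$, the *random surface measure* on $G$ with potential $U$ and zero boundary values on $V_0$ is the probability measure on functions $\varphi:V(G)\to\mathbb R$ given by $$d\mu(\varphi)=\frac1Z\exp\Big(-\sum_{e\in E(G)}U(\nabla_e\varphi)\Big)\prod_{v\in V_0}\delta_0(d\varphi(v))\prod_{v\in V(G)\setminus V_0}d\varphi(v),$$ where $\nabla_e\varphi=\varphi(u)-\varphi(w)$ for an edge $e=(u,w)$ (the edges carry a fixed orientation, whose choice is immaterial because $U$ is even), $d\varphi(v)$ is Lebesgue measure on $\mathbb R$, and $Z$ is the normalizing constant. Let $d\ge 3$ be an integer, let $p>2$ be real, and set $U(x)=|x|^p+x^2$. Then there exist constants $C,c>0$, depending only on $p$ and $d$, such that the following holds for every integer $L\ge2$ in each of these two settings: 1. (Torus) $V(G)=\{-L+1,-L+2,\dots,L\}^d$, where two vertices are adjacent when they are equal in all but one coordinate and differ by exactly one modulo $2L$ in that coordinate, and $V_0=\{(0,\dots,0)\}$. 2. (Box) $V(G)=\{1,\dots,L\}^d$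 with the nearest-neighbor adjacency of $\mathbb Z^d$, and $V_0$ is the set of vertices of $V(G)$ that are adjacent in $\mathbb Z^d$ to a vertex outside $V(G)$. The random surface measure $\mu$ is well defined ($0<Z<\infty$) and, if $\varphi$ is sampled from $\mu$, then for every $v\in V(G)\setminus V_0$ and every real $t>2$, $$\mathbb P(|\varphi(v)|>t)\le\begin{cases}C\exp(-c\,t^d)&\text{if } d<p,\\[2pt] C\exp\Big(-c\,\dfrac{t^d}{(\log t)^{d-1}}\Big)&\text{if } d=p,\\[2pt] C\exp(-c\,t^p)&\text{if } d>p.\end{cases}$$ -/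

import Mathlib

open MeasureTheory

noncomputable section

namespace RandomSurface

/-! ### The random surface model on a finite graph -/

section Model

variable {V : Type*}

/-- The discrete gradient `φ u - φ v` of `φ` along the edge `e`, for a fixed (chosen) orientation
`e = (u, v)` of every edge. -/
def grad (φ : V → ℝ) (e : Sym2 V) : ℝ :=
  φ (Quot.out e).1 - φ (Quot.out e).2

/-- For an even potential the choice of the orientation of the edges is immaterial. -/
theorem potential_grad {U : ℝ → ℝ} (hU : ∀ x, U (-x) = U x) (φ : V → ℝ) (u v : V) :
    U (grad φ s(u, v)) = U (φ u - φ v) := by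
  have h : s((Quot.out s(u, v)).1, (Quot.out s(u, v)).2) = s(u, v) :=
    Quot.out_eq (s(u, v) : Sym2 V)
  rcases Sym2.eq_iff.1 h with ⟨h1, h2⟩ | ⟨h1, h2⟩
  · rw [grad, h1, h2]
  · rw [grad, h1, h2, ← hU, neg_sub]

variable [Fintype V]

open Classical in
/-- The energy `∑_{e ∈ E(G)} U(∇_e φ)`. -/
def energy (G : SimpleGraph V) (U : ℝ → ℝ) (φ : V → ℝ) : ℝ :=
  ∑ e ∈ G.edgeFinset, U (grad φ e)

open Classical in
/-- The measure `∏_{v ∈ V₀} δ(φ(v) - φ₀(v)) ∏_{v ∉ V₀} dφ(v)` on `V → ℝ`. -/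
def refMeasure (V₀ : Set V) (φ₀ : V₀ → ℝ) : Measure (V → ℝ) :=
  Measure.pi fun v => if h : v ∈ V₀ then Measure.dirac (φ₀ ⟨v, h⟩) else volume

/-- The partition function. -/
def partitionFunction (G : SimpleGraph V) (V₀ : Set V) (φ₀ : V₀ → ℝ) (U : ℝ → ℝ) : ENNReal :=
  ∫⁻ φ, ENNReal.ofReal (Real.exp (-energy G U φ)) ∂(refMeasure V₀ φ₀)

/-- The random surface measure on `G` with potential `U` and boundary conditions `(V₀, φ₀)`.
It is a probability measure whenever the partition function lies in `(0, ∞)`. -/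
def surfaceMeasure (G : SimpleGraph V) (V₀ : Set V) (φ₀ : V₀ → ℝ) (U : ℝ → ℝ) :
    Measure (V → ℝ) :=
  (partitionFunction G V₀ φ₀ U)⁻¹ •
    (refMeasure V₀ φ₀).withDensity fun φ => ENNReal.ofReal (Real.exp (-energy G U φ))

end Model

/-! ### The torus with the origin pinned -/

/-- The vertex set `{-L+1, …, L}^d`. -/
abbrev TorusVertex (d L : ℕ) : Type :=
  Fin d → Finset.Icc (-(L : ℤ) + 1) (L : ℤ)

/-- The torus of side `2L`: two vertices are adjacent when they are equal in all but one
coordinate and differ by exactly one modulo `2L` in that coordinate. -/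
def torus (d L : ℕ) : SimpleGraph (TorusVertex d L) where
  Adj v w := ∃ i, (∀ j, j ≠ i → v j = w j) ∧
    ((v i : ℤ) - w i ≡ 1 [ZMOD 2 * (L : ℤ)] ∨ (w i : ℤ) - v i ≡ 1 [ZMOD 2 * (L : ℤ)])
  symm := by
    refine ⟨?_⟩
    rintro v w ⟨i, h, h'⟩
    exact ⟨i, fun j hj => (h j hj).symm, h'.symm⟩
  loopless := by
    refine ⟨?_⟩
    rintro v ⟨i, -, h⟩
    have h1 : (0 : ℤ) ≡ 1 [ZMOD 2 * (L : ℤ)] := by simpa using h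
    have h2 : (2 : ℤ) ∣ 1 - 0 := (Dvd.intro _ rfl).trans h1.dvd
    omega

/-- The pinned set of the torus: the origin only. -/
def torusBoundary (d L : ℕ) : Set (TorusVertex d L) :=
  {v | ∀ i, (v i : ℤ) = 0}

/-! ### The box with zero boundary values -/

/-- The nearest-neighbour graph on `ℤ^d`. -/
def latticeGraph (d : ℕ) : SimpleGraph (Fin d → ℤ) where
  Adj v w := ∑ i, |v i - w i| = 1
  symm := by
    refine ⟨?_⟩
    intro v w h
    simpa only [abs_sub_comm] using h
  loopless := by
    refine ⟨?_⟩
    intro v h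
    simp at h

/-- The vertex set `{1, …, L}^d`. -/
abbrev BoxVertex (d L : ℕ) : Type :=
  Fin d → Finset.Icc (1 : ℤ) (L : ℤ)

/-- The inclusion of the box into `ℤ^d`. -/
def BoxVertex.toLattice {d L : ℕ} (v : BoxVertex d L) : Fin d → ℤ :=
  fun i => (v i : ℤ)

/-- The box with nearest-neighbour adjacency. -/
def box (d L : ℕ) : SimpleGraph (BoxVertex d L) :=
  (latticeGraph d).comap BoxVertex.toLattice

/-- The vertices of the box that are adjacent in `ℤ^d` to a vertex outside the box. -/
def boxBoundary (d L : ℕ) : Set (BoxVertex d L) :=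
  {v | ∃ w : Fin d → ℤ, (latticeGraph d).Adj v.toLattice w ∧
    w ∉ Set.range (BoxVertex.toLattice (d := d) (L := L))}

/-! ### The potential, the two measures and the decay rate -/

/-- The potential `U(x) = |x|^p + x^2`. -/
def potential (p x : ℝ) : ℝ :=
  |x| ^ p + x ^ 2

/-- The random surface measure on the torus, with the value zero at the origin. -/
def torusMeasure (d L : ℕ) (U : ℝ → ℝ) : Measure (TorusVertex d L → ℝ) :=
  surfaceMeasure (torus d L) (torusBoundary d L) (fun _ => 0) U

/-- The random surface measure on the box, with zero boundary values. -/
def boxMeasure (d L : ℕ) (U : ℝ → ℝ) : Measure (BoxVertex d L → ℝ) :=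
  surfaceMeasure (box d L) (boxBoundary d L) (fun _ => 0) U

/-- The decay rate: `t^d` if `d < p`, `t^d / (log t)^(d-1)` if `d = p`, and `t^p` if `d > p`. -/
def tailRate (d : ℕ) (p t : ℝ) : ℝ :=
  if (d : ℝ) < p then t ^ d
  else if (d : ℝ) = p then t ^ d / Real.log t ^ (d - 1)
  else t ^ p

end RandomSurface

end

namespace RandomSurface

open ENNReal

/-! ### The Prékopa–Leindler inequality -/

/-! The tail probability is governed by the least energy of a surface that vanishes on the pinned
set and reaches height `t`. Clarkson's inequality for the potential says that averaging two surfaces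
costs no more than half their total energy, even after the energy of their half-difference is added.
If one surface exceeds `t` at `v` and the other is below `-t`, the half-difference reaches `t` and
contributes at least the least energy `m`. Prékopa–Leindler and the symmetry under negation turn
this pointwise gain into the bound `2 exp (-m)` (`surfaceMeasure_tail_le`), so no further
probability is needed.

It remains to bound `m` from below, uniformly in `L`. Both graphs embed in the torus of side `2L`,
where a pinned surface extends by zero at the cost of a factor in the energy (`IsTorusEmbedding`).
On the torus, telescoping averages over dyadic cubes around the two points bound a height difference
by gradient sums over cubes of side `2 ^ k`, weighted by `2 ^ (-k (d - 1))`
(`exists_abs_sub_le_multiscale`).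

These scales are split near `2 ^ k = t`. Coarse scales are paired with the quadratic energy by
Cauchy–Schwarz and force energy of order `t ^ d`; fine scales are paired with the `p`-energy by
Hölder and force `t ^ p` divided by a power of a geometric sum (`exists_tailRate_le_of_multiscale`).
The ratio of that sum is above, equal to or below one according to the sign of `p - d`, which
produces the three regimes. -/

theorem volume_add_le_of_isCompact {A B C : Set ℝ} (hA : IsCompact A) (hB : IsCompact B)
    (hA0 : A.Nonempty) (hB0 : B.Nonempty) (hC : ∀ a ∈ A, ∀ b ∈ B, (a + b) / 2 ∈ C) :
    volume A + volume B ≤ 2 * volume C := by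
  obtain ⟨a₀, ha₀, ha⟩ := hA.exists_isGreatest hA0
  obtain ⟨b₀, hb₀, hb⟩ := hB.exists_isLeast hB0
  have key : ∀ (S : Set ℝ) (c : ℝ),
      2 * volume ((fun x : ℝ => 2 * x) ⁻¹' ((fun x => x + -c) ⁻¹' S)) = volume S := by
    intro S c
    rw [Real.volume_preimage_mul_left two_ne_zero, measure_preimage_add_right, ← mul_assoc,
      abs_of_pos (by norm_num : (0 : ℝ) < 2⁻¹), ENNReal.ofReal_inv_of_pos two_pos,
      ENNReal.ofReal_ofNat, ENNReal.mul_inv_cancel two_ne_zero ofNat_ne_top, one_mul]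
  -- These are the halves of `A + b₀` and `B + a₀`, both inside `C`. As `a₀` is the maximum of `A`
  -- and `b₀` the minimum of `B`, they lie on opposite sides of `(a₀ + b₀) / 2` and meet at most
  -- there.
  set A' := (fun x : ℝ => 2 * x) ⁻¹' ((fun x => x + -b₀) ⁻¹' A) with hA'
  set B' := (fun x : ℝ => 2 * x) ⁻¹' ((fun x => x + -a₀) ⁻¹' B) with hB'
  have hBm : MeasurableSet B' :=
    (hB.measurableSet.preimage (measurable_add_const _)).preimage (measurable_const_mul _)
  have hdisj : AEDisjoint volume A' B' := by
    refine measure_mono_null (t := {(a₀ + b₀) / 2}) ?_ (measure_singleton _)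
    rintro x ⟨hx1, hx2⟩
    have h1 := ha (show 2 * x + -b₀ ∈ A from hx1)
    have h2 := hb (show 2 * x + -a₀ ∈ B from hx2)
    rw [Set.mem_singleton_iff]
    linarith
  rw [← key A b₀, ← key B a₀, ← mul_add, ← measure_union₀ hBm.nullMeasurableSet hdisj]
  gcongr
  rintro x (hx | hx)
  · have := hC _ hx b₀ hb₀
    convert this using 1
    ring
  · have := hC a₀ ha₀ _ hx
    convert this using 1
    ring

/-- The Brunn–Minkowski inequality on the line, for midpoints. -/
theorem volume_add_le_of_midpoint_mem {A B C : Set ℝ} (hA : MeasurableSet A)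
    (hB : MeasurableSet B) (hA0 : A.Nonempty) (hB0 : B.Nonempty)
    (hC : ∀ a ∈ A, ∀ b ∈ B, (a + b) / 2 ∈ C) :
    volume A + volume B ≤ 2 * volume C := by
  obtain ⟨a, ha⟩ := hA0
  obtain ⟨b, hb⟩ := hB0
  rw [hA.measure_eq_iSup_isCompact, hB.measure_eq_iSup_isCompact]
  have := ENNReal.biSup_add_biSup_le' (ι := Set ℝ) (κ := Set ℝ) (p := fun K => K ⊆ A ∧ IsCompact K)
    (q := fun K => K ⊆ B ∧ IsCompact K) ⟨∅, by simp⟩ ⟨∅, by simp⟩ (f := fun K => volume K)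
    (g := fun K => volume K) (a := 2 * volume C) ?_
  · simpa only [iSup_and] using this
  rintro K ⟨hKA, hK⟩ K' ⟨hKB, hK'⟩
  -- The approximating compact sets may be empty; adjoining a fixed point of `A` and of `B` makes
  -- the compact case applicable.
  calc volume K + volume K' ≤ volume (insert a K) + volume (insert b K') := by
        gcongr <;> exact Set.subset_insert _ _
    _ ≤ _ := volume_add_le_of_isCompact (hK.insert a) (hK'.insert b) (Set.insert_nonempty _ _)
        (Set.insert_nonempty _ _) fun x hx y hy =>
          hC x (Set.insert_subset ha hKA hx) y (Set.insert_subset hb hKB hy)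

theorem four_mul_le_add_sq (x y : ℝ≥0∞) : 4 * (x * y) ≤ (x + y) ^ 2 := by
  wlog h : x ≤ y generalizing x y
  · rw [mul_comm x y, add_comm x y]
    exact this y x (le_of_not_ge h)
  obtain ⟨z, rfl⟩ := exists_add_of_le h
  calc 4 * (x * (x + z)) ≤ 4 * (x * (x + z)) + z ^ 2 := le_self_add
    _ = _ := by ring

theorem lintegral_eq_lintegral_volume_lt {f : ℝ → ℝ≥0∞} (hf : Measurable f) (h1 : ∀ x, f x ≤ 1) :
    ∫⁻ x, f x = ∫⁻ s in Set.Ioi (0 : ℝ), volume {x | ENNReal.ofReal s < f x} := by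
  have hfin : ∀ x, f x ≠ ⊤ := fun x => ne_top_of_le_ne_top one_ne_top (h1 x)
  have := lintegral_eq_lintegral_meas_lt (volume : Measure ℝ) (f := fun x => (f x).toReal)
    (Filter.Eventually.of_forall fun x => toReal_nonneg) hf.ennreal_toReal.aemeasurable
  simp only [ofReal_toReal (hfin _)] at this
  rw [this]
  refine setLIntegral_congr_fun measurableSet_Ioi fun s hs => ?_
  congr 1
  ext x
  exact (ENNReal.ofReal_lt_iff_lt_toReal (le_of_lt hs) (hfin x)).symm

/-- Layer-cake argument: with both suprema equal to one, the superlevel sets of `f` and `g` at any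
level below one are nonempty, and their midpoints lie in the superlevel set of `h`. Brunn–Minkowski
is then integrated over the levels. Truncating `h` at one loses nothing that is needed. -/
theorem lintegral_add_le_of_iSup_eq_one {f g h : ℝ → ℝ≥0∞} (hf : Measurable f)
    (hg : Measurable g) (hh : Measurable h) (hf1 : ⨆ x, f x = 1) (hg1 : ⨆ x, g x = 1)
    (H : ∀ x y, f x * g y ≤ h ((x + y) / 2) ^ 2) :
    (∫⁻ x, f x) + ∫⁻ x, g x ≤ 2 * ∫⁻ x, h x := by
  have hfle : ∀ x, f x ≤ 1 := fun x => hf1 ▸ le_iSup f x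
  have hgle : ∀ x, g x ≤ 1 := fun x => hg1 ▸ le_iSup g x
  have hle : ∫⁻ x, min (h x) 1 ≤ ∫⁻ x, h x := lintegral_mono fun x => min_le_left _ _
  refine le_trans ?_ (mul_le_mul_right hle 2)
  rw [lintegral_eq_lintegral_volume_lt hf hfle, lintegral_eq_lintegral_volume_lt hg hgle,
    lintegral_eq_lintegral_volume_lt (hh.min measurable_const) fun x => min_le_right _ _]
  have hanti : ∀ k : ℝ → ℝ≥0∞, Measurable fun s : ℝ => volume {x | ENNReal.ofReal s < k x} := by
    intro k
    refine Antitone.measurable fun s t hst => measure_mono fun x hx => ?_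
    exact lt_of_le_of_lt (ofReal_le_ofReal hst) hx
  rw [← lintegral_add_left (hanti _), ← lintegral_const_mul _ (hanti _)]
  refine setLIntegral_mono ((hanti _).const_mul _) fun s hs => ?_
  rcases lt_or_ge s 1 with hs1 | hs1
  · have hs1' : ENNReal.ofReal s < 1 := by simpa using hs1
    obtain ⟨u, hu⟩ := lt_iSup_iff.1 (hf1.symm ▸ hs1')
    obtain ⟨v, hv⟩ := lt_iSup_iff.1 (hg1.symm ▸ hs1')
    refine volume_add_le_of_midpoint_mem (measurableSet_lt measurable_const hf)
      (measurableSet_lt measurable_const hg) ⟨u, hu⟩ ⟨v, hv⟩ fun a ha b hb => ?_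
    refine lt_min ?_ hs1'
    by_contra hcon
    refine absurd ((H a b).trans (pow_le_pow_left' (not_lt.1 hcon) 2)) (not_le.2 ?_)
    rw [sq]
    exact ENNReal.mul_lt_mul ha hb
  · have hs1' : 1 ≤ ENNReal.ofReal s := by simpa using hs1
    have h0 : ∀ k : ℝ → ℝ≥0∞, (∀ x, k x ≤ 1) → {x | ENNReal.ofReal s < k x} = ∅ := by
      intro k hk
      ext x
      simpa using (hk x).trans hs1'
    rw [h0 f hfle, h0 g hgle]
    simp

/-- Rescaling `f`, `g` by their suprema and `h` by the geometric mean of these reduces to the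
additive inequality; the arithmetic-geometric mean inequality makes it multiplicative. -/
theorem lintegral_mul_lintegral_le_of_bounded {f g h : ℝ → ℝ≥0∞} (hf : Measurable f)
    (hg : Measurable g) (hh : Measurable h) (hf1 : ⨆ x, f x ≠ ⊤) (hg1 : ⨆ x, g x ≠ ⊤)
    (H : ∀ x y, f x * g y ≤ h ((x + y) / 2) ^ 2) :
    (∫⁻ x, f x) * ∫⁻ x, g x ≤ (∫⁻ x, h x) ^ 2 := by
  set a := ⨆ x, f x with ha
  set b := ⨆ x, g x with hb
  by_cases ha0 : a = 0
  · have : f = 0 := funext fun x => ENNReal.iSup_eq_zero.1 ha0 x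
    simp [this]
  by_cases hb0 : b = 0
  · have : g = 0 := funext fun x => ENNReal.iSup_eq_zero.1 hb0 x
    simp [this]
  obtain ⟨c, hc⟩ : ∃ c : ℝ≥0∞, c ^ 2 = a * b := by
    refine ⟨(a * b) ^ (1 / 2 : ℝ), ?_⟩
    rw [← ENNReal.rpow_natCast, ← ENNReal.rpow_mul]
    norm_num
  have hab : a * b ≠ ⊤ := mul_ne_top hf1 hg1
  have hc0 : c ≠ 0 := by
    rintro rfl
    exact mul_ne_zero ha0 hb0 (by rw [← hc]; simp)
  have hct : c ≠ ⊤ := by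
    rintro rfl
    exact hab (by rw [← hc]; simp)
  have key := lintegral_add_le_of_iSup_eq_one (hf.const_mul a⁻¹) (hg.const_mul b⁻¹)
    (hh.const_mul c⁻¹) (by rw [← ENNReal.mul_iSup, ENNReal.inv_mul_cancel ha0 hf1])
    (by rw [← ENNReal.mul_iSup, ENNReal.inv_mul_cancel hb0 hg1]) (fun x y => by
      rw [mul_pow, ← ENNReal.inv_pow, hc, ENNReal.mul_inv (Or.inl ha0) (Or.inl hf1)]
      calc a⁻¹ * f x * (b⁻¹ * g y) = a⁻¹ * b⁻¹ * (f x * g y) := by ring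
        _ ≤ _ := by gcongr; exact H x y)
  rw [lintegral_const_mul _ hf, lintegral_const_mul _ hg, lintegral_const_mul _ hh] at key
  set F := ∫⁻ x, f x
  set G := ∫⁻ x, g x
  set I := ∫⁻ x, h x
  have h4 : 4 * ((a⁻¹ * F) * (b⁻¹ * G)) ≤ 4 * (c⁻¹ * I) ^ 2 := by
    calc _ ≤ (a⁻¹ * F + b⁻¹ * G) ^ 2 := four_mul_le_add_sq _ _
      _ ≤ (2 * (c⁻¹ * I)) ^ 2 := by gcongr
      _ = _ := by ring
  have h5 := (ENNReal.mul_le_mul_iff_right (by norm_num) (by norm_num)).1 h4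
  calc F * G = (a * b) * ((a⁻¹ * F) * (b⁻¹ * G)) := by
        rw [show (a * b) * ((a⁻¹ * F) * (b⁻¹ * G)) = (a * a⁻¹) * (b * b⁻¹) * (F * G) by ring,
          ENNReal.mul_inv_cancel ha0 hf1, ENNReal.mul_inv_cancel hb0 hg1, one_mul, one_mul]
    _ ≤ (a * b) * (c⁻¹ * I) ^ 2 := by gcongr
    _ = I ^ 2 := by
        rw [← hc, ← mul_pow, ← mul_assoc, ENNReal.mul_inv_cancel hc0 hct, one_mul]

theorem iSup_min_natCast (x : ℝ≥0∞) : ⨆ n : ℕ, min x n = x := by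
  rw [← inf_iSup_eq, ENNReal.iSup_natCast, inf_top_eq]

/-- A measure satisfies the midpoint Prékopa–Leindler inequality. -/
def MidpointPrekopaLeindler (μ : Measure ℝ) : Prop :=
  ∀ f g h : ℝ → ℝ≥0∞, Measurable f → Measurable g → Measurable h →
    (∀ x y, f x * g y ≤ h ((x + y) / 2) ^ 2) →
    (∫⁻ x, f x ∂μ) * ∫⁻ x, g x ∂μ ≤ (∫⁻ x, h x ∂μ) ^ 2

theorem midpointPrekopaLeindler_volume : MidpointPrekopaLeindler volume := by
  intro f g h hf hg hh H
  have hmono : ∀ k : ℝ → ℝ≥0∞, Measurable k →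
      ⨆ n : ℕ, ∫⁻ x, min (k x) n = ∫⁻ x, k x := by
    intro k hk
    rw [← lintegral_iSup (fun n => hk.min measurable_const)]
    · simp only [iSup_min_natCast]
    · intro m n hmn x
      exact min_le_min_left _ (by exact_mod_cast hmn)
  have hbd : ∀ (k : ℝ → ℝ≥0∞) (n : ℕ), ⨆ x, min (k x) (n : ℝ≥0∞) ≠ ⊤ := fun k n =>
    ne_top_of_le_ne_top (natCast_ne_top n) (iSup_le fun x => min_le_right _ _)
  rw [← hmono f hf, ← hmono g hg, ENNReal.iSup_mul]
  refine iSup_le fun n => ?_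
  rw [ENNReal.mul_iSup]
  refine iSup_le fun m => ?_
  refine lintegral_mul_lintegral_le_of_bounded (hf.min measurable_const)
    (hg.min measurable_const) hh (hbd f n) (hbd g m) fun x y => le_trans ?_ (H x y)
  gcongr <;> exact min_le_left _ _

theorem midpointPrekopaLeindler_dirac (a : ℝ) : MidpointPrekopaLeindler (Measure.dirac a) := by
  intro f g h hf hg hh H
  rw [lintegral_dirac' _ hf, lintegral_dirac' _ hg, lintegral_dirac' _ hh]
  simpa using H a a

/-- The Prékopa–Leindler inequality (for midpoints) on a finite product. -/
theorem lintegral_pi_mul_lintegral_pi_le {ι : Type*} [Fintype ι] (μ : ι → Measure ℝ)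
    [∀ i, SigmaFinite (μ i)] (hμ : ∀ i, MidpointPrekopaLeindler (μ i))
    {f g h : (ι → ℝ) → ℝ≥0∞} (hf : Measurable f) (hg : Measurable g) (hh : Measurable h)
    (H : ∀ x y : ι → ℝ, f x * g y ≤ h (fun i => (x i + y i) / 2) ^ 2) :
    (∫⁻ x, f x ∂Measure.pi μ) * ∫⁻ x, g x ∂Measure.pi μ ≤ (∫⁻ x, h x ∂Measure.pi μ) ^ 2 := by
  classical
  -- Marginals inherit the midpoint hypothesis in the remaining variables, so coordinates can be
  -- integrated out one at a time.
  have key : ∀ (s : Finset ι) (x y : ι → ℝ),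
      lmarginal μ s f x * lmarginal μ s g y ≤
        lmarginal μ s h (fun i => (x i + y i) / 2) ^ 2 := by
    intro s
    induction s using Finset.induction_on with
    | empty => simpa using H
    | insert i s hi ih =>
      intro x y
      rw [lmarginal_insert f hf hi, lmarginal_insert g hg hi, lmarginal_insert h hh hi]
      refine hμ i _ _ _ ?_ ?_ ?_ fun u v => ?_
      · exact (hf.lmarginal μ).comp (measurable_update x)
      · exact (hg.lmarginal μ).comp (measurable_update y)
      · exact (hh.lmarginal μ).comp (measurable_update _)
      · convert ih (Function.update x i u) (Function.update y i v) using 3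
        ext j
        by_cases hj : j = i
        · subst hj; simp
        · simp [hj]
  simpa using key Finset.univ 0 0

/-! ### The potential -/

theorem potential_neg (p x : ℝ) : potential p (-x) = potential p x := by
  simp [potential]

theorem potential_nonneg (p x : ℝ) : 0 ≤ potential p x := by
  unfold potential; positivity

theorem continuous_potential {p : ℝ} (hp : 0 ≤ p) : Continuous (potential p) :=
  (continuous_abs.rpow_const fun _ => Or.inr hp).add (continuous_pow 2)

/-- Clarkson's inequality on the line. -/
theorem abs_rpow_midpoint_add_le {p : ℝ} (hp : 2 ≤ p) (x y : ℝ) :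
    |(x + y) / 2| ^ p + |(x - y) / 2| ^ p ≤ (|x| ^ p + |y| ^ p) / 2 := by
  have hq : 1 ≤ p / 2 := by linarith
  have hsq : ∀ z : ℝ, |z| ^ p = (z ^ 2) ^ (p / 2) := by
    intro z
    rw [← sq_abs, ← Real.rpow_natCast, ← Real.rpow_mul (abs_nonneg z)]
    congr 1
    push_cast
    ring
  rw [hsq, hsq, hsq, hsq]
  have hconv := (convexOn_rpow hq).2 (Set.mem_Ici.2 (sq_nonneg x)) (Set.mem_Ici.2 (sq_nonneg y))
    (by norm_num : (0 : ℝ) ≤ 1 / 2) (by norm_num : (0 : ℝ) ≤ 1 / 2) (by norm_num)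
  simp only [smul_eq_mul] at hconv
  -- Superadditivity of the power `p / 2`, then the parallelogram identity, then convexity.
  calc _ ≤ (((x + y) / 2) ^ 2 + ((x - y) / 2) ^ 2) ^ (p / 2) :=
        Real.add_rpow_le_rpow_add (sq_nonneg _) (sq_nonneg _) hq
    _ = (1 / 2 * x ^ 2 + 1 / 2 * y ^ 2) ^ (p / 2) := by congr 1; ring
    _ ≤ _ := hconv
    _ = _ := by ring

theorem potential_midpoint_add_le {p : ℝ} (hp : 2 ≤ p) (x y : ℝ) :
    potential p ((x + y) / 2) + potential p ((x - y) / 2) ≤ (potential p x + potential p y) / 2 := by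
  have := abs_rpow_midpoint_add_le hp x y
  unfold potential
  nlinarith

/-! ### The reference measure -/

section

variable {V : Type*} (V₀ : Set V)

open Classical in
/-- The factors of the reference measure with zero boundary values. -/
noncomputable def pinnedMeasure (v : V) : Measure ℝ := if v ∈ V₀ then Measure.dirac 0 else volume

theorem pinnedMeasure_of_mem {v : V} (h : v ∈ V₀) : pinnedMeasure V₀ v = Measure.dirac 0 :=
  if_pos h

theorem pinnedMeasure_of_notMem {v : V} (h : v ∉ V₀) : pinnedMeasure V₀ v = volume :=
  if_neg h

instance (v : V) : SigmaFinite (pinnedMeasure V₀ v) := by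
  unfold pinnedMeasure; split_ifs <;> infer_instance

instance (v : V) : (pinnedMeasure V₀ v).IsNegInvariant := by
  by_cases h : v ∈ V₀
  · rw [pinnedMeasure_of_mem V₀ h]
    refine ⟨?_⟩
    rw [Measure.neg_def, Measure.map_dirac' measurable_neg, neg_zero]
  · rw [pinnedMeasure_of_notMem V₀ h]
    infer_instance

theorem midpointPrekopaLeindler_pinnedMeasure (v : V) :
    MidpointPrekopaLeindler (pinnedMeasure V₀ v) := by
  unfold pinnedMeasure
  split_ifs
  · exact midpointPrekopaLeindler_dirac 0
  · exact midpointPrekopaLeindler_volume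

end

/-! ### The energy -/

section

variable {V : Type*} [Fintype V] (G : SimpleGraph V) (V₀ : Set V)

theorem energy_neg {U : ℝ → ℝ} (hU : ∀ x, U (-x) = U x) (φ : V → ℝ) :
    energy G U (-φ) = energy G U φ := by
  refine Finset.sum_congr rfl fun e _ => ?_
  rw [← hU (grad φ e)]
  congr 1
  simp only [grad, Pi.neg_apply]
  ring

theorem energy_midpoint_add_le {U : ℝ → ℝ}
    (hU : ∀ x y, U ((x + y) / 2) + U ((x - y) / 2) ≤ (U x + U y) / 2) (φ ψ : V → ℝ) :
    energy G U (fun v => (φ v + ψ v) / 2) + energy G U (fun v => (φ v - ψ v) / 2) ≤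
      (energy G U φ + energy G U ψ) / 2 := by
  unfold energy
  rw [← Finset.sum_add_distrib, ← Finset.sum_add_distrib, Finset.sum_div]
  refine Finset.sum_le_sum fun e _ => ?_
  have h1 : grad (fun v => (φ v + ψ v) / 2) e = (grad φ e + grad ψ e) / 2 := by
    simp only [grad]; ring
  have h2 : grad (fun v => (φ v - ψ v) / 2) e = (grad φ e - grad ψ e) / 2 := by
    simp only [grad]; ring
  rw [h1, h2]
  exact hU _ _

theorem continuous_energy {U : ℝ → ℝ} (hU : Continuous U) : Continuous (energy G U) := by
  unfold energy grad
  fun_prop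

theorem refMeasure_zero :
    refMeasure V₀ (fun _ => 0) = Measure.pi (pinnedMeasure V₀) := by
  unfold refMeasure pinnedMeasure
  congr 1

theorem ae_eq_zero_of_mem :
    ∀ᵐ φ ∂Measure.pi (pinnedMeasure V₀), ∀ v ∈ V₀, φ v = 0 := by
  refine Filter.eventually_all.2 fun v => ?_
  by_cases h : v ∈ V₀
  · have : ∀ᵐ x ∂pinnedMeasure V₀ v, x = 0 := by
      rw [pinnedMeasure_of_mem V₀ h]
      simp [ae_dirac_eq]
    filter_upwards [Measure.tendsto_eval_ae_ae.eventually this] with φ hφ _ using hφ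
  · exact Filter.Eventually.of_forall fun φ hv => absurd hv h

theorem partitionFunction_ne_zero {U : ℝ → ℝ} (hU : Continuous U) :
    partitionFunction G V₀ (fun _ => 0) U ≠ 0 := by
  unfold partitionFunction
  rw [refMeasure_zero]
  intro h
  rw [lintegral_eq_zero_iff (by have := continuous_energy G hU; fun_prop)] at h
  have h0 : ∀ᵐ φ ∂Measure.pi (pinnedMeasure V₀), False := by
    filter_upwards [h] with φ hφ
    simp only [Pi.zero_apply, ENNReal.ofReal_eq_zero] at hφ
    exact absurd hφ (not_le.2 (Real.exp_pos _))
  have h1 : Measure.pi (pinnedMeasure V₀) Set.univ = 0 := by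
    simpa [ae_iff] using h0
  rw [Measure.pi_univ, Finset.prod_eq_zero_iff] at h1
  obtain ⟨v, -, hv⟩ := h1
  by_cases h : v ∈ V₀
  · simp [pinnedMeasure_of_mem V₀ h] at hv
  · simp [pinnedMeasure_of_notMem V₀ h] at hv

/-- Coercivity gives domination by a product Gaussian. It is needed only for surfaces vanishing on
`V₀`, which carry the whole reference measure. -/
theorem partitionFunction_ne_top {U : ℝ → ℝ} {c : ℝ} (hc : 0 < c)
    (h : ∀ φ : V → ℝ, (∀ v ∈ V₀, φ v = 0) → ∑ v, c * φ v ^ 2 ≤ energy G U φ) :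
    partitionFunction G V₀ (fun _ => 0) U ≠ ⊤ := by
  have hint : Integrable (fun φ : V → ℝ => ∏ v, Real.exp (-c * φ v ^ 2))
      (Measure.pi (pinnedMeasure V₀)) := by
    refine Integrable.fintype_prod (f := fun _ x => Real.exp (-c * x ^ 2)) fun v => ?_
    by_cases h : v ∈ V₀
    · rw [pinnedMeasure_of_mem V₀ h]
      exact integrable_dirac (by simp)
    · rw [pinnedMeasure_of_notMem V₀ h]
      exact integrable_exp_neg_mul_sq hc
  unfold partitionFunction
  rw [refMeasure_zero]
  refine ne_top_of_le_ne_top hint.lintegral_lt_top.ne (lintegral_mono_ae ?_)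
  filter_upwards [ae_eq_zero_of_mem V₀] with φ hφ
  refine ENNReal.ofReal_le_ofReal ?_
  rw [← Real.exp_sum, Real.exp_le_exp]
  simp only [neg_mul, Finset.sum_neg_distrib]
  exact neg_le_neg (h φ hφ)

theorem isProbabilityMeasure_surfaceMeasure {U : ℝ → ℝ}
    (h0 : partitionFunction G V₀ (fun _ => 0) U ≠ 0)
    (ht : partitionFunction G V₀ (fun _ => 0) U ≠ ⊤) :
    IsProbabilityMeasure (surfaceMeasure G V₀ (fun _ => 0) U) := by
  refine ⟨?_⟩
  unfold surfaceMeasure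
  rw [Measure.smul_apply, withDensity_apply _ MeasurableSet.univ, Measure.restrict_univ,
    smul_eq_mul]
  exact ENNReal.inv_mul_cancel h0 ht

/-- Prékopa–Leindler is applied to the weight restricted to heights above `t` and to heights below
`-t`, against `exp (-m)` times the full weight. The two restricted integrals agree by symmetry, so
the product inequality is an inequality of squares. -/
theorem lintegral_upper_tail_le {U : ℝ → ℝ} (hU : Continuous U) (heven : ∀ x, U (-x) = U x)
    (hcl : ∀ x y, U ((x + y) / 2) + U ((x - y) / 2) ≤ (U x + U y) / 2) (v : V) {t m : ℝ}
    (hm : ∀ φ : V → ℝ, (∀ u ∈ V₀, φ u = 0) → t ≤ φ v → m ≤ energy G U φ) :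
    ∫⁻ φ in {φ | t < φ v}, ENNReal.ofReal (Real.exp (-energy G U φ))
        ∂Measure.pi (pinnedMeasure V₀) ≤
      ENNReal.ofReal (Real.exp (-m)) * partitionFunction G V₀ (fun _ => 0) U := by
  have hcont := continuous_energy G hU
  set w : (V → ℝ) → ℝ≥0∞ := fun φ => ENNReal.ofReal (Real.exp (-energy G U φ)) with hw
  have hwm : Measurable w := by fun_prop
  have hZm : MeasurableSet {φ : V → ℝ | ∀ u ∈ V₀, φ u = 0} := by
    have : {φ : V → ℝ | ∀ u ∈ V₀, φ u = 0} = ⋂ u ∈ V₀, {φ : V → ℝ | φ u = 0} := by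
      ext; simp
    rw [this]
    exact MeasurableSet.biInter (Set.to_countable _) fun u _ =>
      measurableSet_eq_fun (measurable_pi_apply u) measurable_const
  set A : Set (V → ℝ) := {φ | ∀ u ∈ V₀, φ u = 0} ∩ {φ | t < φ v} with hA
  set B : Set (V → ℝ) := {φ | ∀ u ∈ V₀, φ u = 0} ∩ {φ | φ v < -t} with hB
  have hAm : MeasurableSet A := hZm.inter (measurableSet_lt measurable_const (measurable_pi_apply v))
  have hBm : MeasurableSet B := hZm.inter (measurableSet_lt (measurable_pi_apply v) measurable_const)
  have hAint : ∫⁻ φ in {φ | t < φ v}, w φ ∂Measure.pi (pinnedMeasure V₀) =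
      ∫⁻ φ, A.indicator w φ ∂Measure.pi (pinnedMeasure V₀) := by
    rw [lintegral_indicator hAm]
    refine setLIntegral_congr ?_
    filter_upwards [ae_eq_zero_of_mem V₀] with φ hφ
    refine propext ⟨fun h => ⟨hφ, h⟩, fun h => h.2⟩
  have hAB : ∫⁻ φ, B.indicator w φ ∂Measure.pi (pinnedMeasure V₀) =
      ∫⁻ φ, A.indicator w φ ∂Measure.pi (pinnedMeasure V₀) := by
    rw [← (Measure.measurePreserving_neg (Measure.pi (pinnedMeasure V₀))).lintegral_comp
      (hwm.indicator hAm)]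
    refine lintegral_congr fun φ => ?_
    have hmem : φ ∈ B ↔ -φ ∈ A := by
      simp only [hA, hB, Set.mem_inter_iff, Set.mem_ofPred_eq, Pi.neg_apply, neg_eq_zero,
        lt_neg]
    by_cases h : φ ∈ B
    · rw [Set.indicator_of_mem h, Set.indicator_of_mem (hmem.1 h), hw]
      simp only [energy_neg G heven]
    · rw [Set.indicator_of_notMem h, Set.indicator_of_notMem (mt hmem.2 h)]
  have key := lintegral_pi_mul_lintegral_pi_le (pinnedMeasure V₀)
    (midpointPrekopaLeindler_pinnedMeasure V₀) (hwm.indicator hAm) (hwm.indicator hBm)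
    (hwm.const_mul (ENNReal.ofReal (Real.exp (-m)))) (fun φ ψ => by
      by_cases hφ : φ ∈ A
      swap
      · simp [Set.indicator_of_notMem hφ]
      by_cases hψ : ψ ∈ B
      swap
      · simp [Set.indicator_of_notMem hψ]
      rw [Set.indicator_of_mem hφ, Set.indicator_of_mem hψ, hw]
      simp only
      rw [← ENNReal.ofReal_mul (Real.exp_pos _).le, ← ENNReal.ofReal_mul (Real.exp_pos _).le,
        ← ENNReal.ofReal_pow (by positivity), ← Real.exp_add, ← Real.exp_add, ← Real.exp_nat_mul]
      refine ENNReal.ofReal_le_ofReal (Real.exp_le_exp.2 ?_)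
      have h1 := energy_midpoint_add_le G hcl φ ψ
      -- The half-difference is still pinned and has height above `t` at `v`; this is the source of
      -- the gain `m`.
      have h2 := hm (fun v => (φ v - ψ v) / 2)
        (fun u hu => by rw [hφ.1 u hu, hψ.1 u hu]; norm_num)
        (by have := hφ.2; have := hψ.2; simp only [Set.mem_ofPred_eq] at *; linarith)
      push_cast
      linarith)
  rw [hAB, lintegral_const_mul _ hwm] at key
  rw [hAint, partitionFunction, refMeasure_zero]
  by_contra hcon
  rw [not_le] at hcon
  refine absurd key (not_le.2 ?_)
  rw [sq]
  exact ENNReal.mul_lt_mul hcon hcon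

/-- If every surface vanishing on `V₀` with height at least `t` at `v` has energy at least `m`,
then the probability of a height above `t` at `v` is at most `2 exp (-m)`. -/
theorem surfaceMeasure_tail_le {U : ℝ → ℝ} (hU : Continuous U) (heven : ∀ x, U (-x) = U x)
    (hcl : ∀ x y, U ((x + y) / 2) + U ((x - y) / 2) ≤ (U x + U y) / 2)
    (h0 : partitionFunction G V₀ (fun _ => 0) U ≠ 0)
    (ht : partitionFunction G V₀ (fun _ => 0) U ≠ ⊤) (v : V) {t m : ℝ}
    (hm : ∀ φ : V → ℝ, (∀ u ∈ V₀, φ u = 0) → t ≤ φ v → m ≤ energy G U φ) :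
    surfaceMeasure G V₀ (fun _ => 0) U {φ | t < |φ v|} ≤ ENNReal.ofReal (2 * Real.exp (-m)) := by
  have hcont := continuous_energy G hU
  set w : (V → ℝ) → ℝ≥0∞ := fun φ => ENNReal.ofReal (Real.exp (-energy G U φ)) with hw
  have hwm : Measurable w := by fun_prop
  have hpos := lintegral_upper_tail_le G V₀ hU heven hcl v hm
  have hset : {φ : V → ℝ | t < |φ v|} = {φ | t < φ v} ∪ Neg.neg ⁻¹' {φ | t < φ v} := by
    ext φ
    simp [lt_abs]
  have hm1 : MeasurableSet {φ : V → ℝ | t < φ v} :=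
    measurableSet_lt measurable_const (measurable_pi_apply v)
  have hneg : ∫⁻ φ in Neg.neg ⁻¹' {φ : V → ℝ | t < φ v}, w φ ∂Measure.pi (pinnedMeasure V₀) =
      ∫⁻ φ in {φ | t < φ v}, w φ ∂Measure.pi (pinnedMeasure V₀) := by
    rw [← (Measure.measurePreserving_neg (Measure.pi (pinnedMeasure V₀))).setLIntegral_comp_preimage
      hm1 hwm]
    simp only [hw, energy_neg G heven]
  unfold surfaceMeasure
  rw [Measure.smul_apply, refMeasure_zero, smul_eq_mul]
  set Z := partitionFunction G V₀ (fun _ => 0) U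
  calc Z⁻¹ * (Measure.pi (pinnedMeasure V₀)).withDensity w {φ | t < |φ v|}
      ≤ Z⁻¹ * (2 * (ENNReal.ofReal (Real.exp (-m)) * Z)) := by
        gcongr
        rw [hset, two_mul]
        refine (measure_union_le _ _).trans (add_le_add ?_ ?_)
        · rwa [withDensity_apply _ hm1]
        · rwa [withDensity_apply _ (hm1.preimage measurable_neg), hneg]
    _ = (Z⁻¹ * Z) * (2 * ENNReal.ofReal (Real.exp (-m))) := by ring
    _ = _ := by
        rw [ENNReal.inv_mul_cancel h0 ht, one_mul, ENNReal.ofReal_mul two_pos.le,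
          ENNReal.ofReal_ofNat]

end

/-! ### Geometric sums -/

theorem sum_range_pow_le {x : ℝ} (h0 : 0 ≤ x) (h1 : x < 1) (n : ℕ) :
    ∑ i ∈ Finset.range n, x ^ i ≤ (1 - x)⁻¹ := by
  rw [← one_div, le_div_iff₀ (by linarith), geom_sum_mul_neg]
  linarith [pow_nonneg h0 n]

theorem sum_pow_le_of_forall_le {x : ℝ} (h0 : 0 ≤ x) (h1 : x < 1) (S : Finset ℕ) {k₀ : ℕ}
    (hS : ∀ k ∈ S, k₀ ≤ k) : ∑ k ∈ S, x ^ k ≤ x ^ k₀ * (1 - x)⁻¹ := by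
  have hsub : S ⊆ Finset.Ico k₀ (S.sup id + 1) := fun k hk =>
    Finset.mem_Ico.2 ⟨hS k hk, Nat.lt_succ_of_le (Finset.le_sup (f := id) hk)⟩
  calc ∑ k ∈ S, x ^ k ≤ ∑ k ∈ Finset.Ico k₀ (S.sup id + 1), x ^ k :=
        Finset.sum_le_sum_of_subset_of_nonneg hsub fun _ _ _ => pow_nonneg h0 _
    _ = x ^ k₀ * ∑ i ∈ Finset.range (S.sup id + 1 - k₀), x ^ i := by
        rw [Finset.sum_Ico_eq_sum_range, Finset.mul_sum]
        simp only [pow_add]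
    _ ≤ _ := by gcongr; exact sum_range_pow_le h0 h1 _

/-- For ratio at most one half a geometric sum is at most twice its leading term, so the power
passes inside up to `2 ^ q`. -/
theorem rpow_sum_pow_le {r q : ℝ} (h0 : 0 < r) (h1 : r ≤ 1 / 2) (hq : 0 < q) (S : Finset ℕ) :
    (∑ k ∈ S, r ^ k) ^ q ≤ 2 ^ q * ∑ k ∈ S, (r ^ q) ^ k := by
  rcases S.eq_empty_or_nonempty with rfl | hne
  · simp [Real.zero_rpow hq.ne']
  have hmin := S.min'_mem hne
  have hle := sum_pow_le_of_forall_le (k₀ := S.min' hne) h0.le (by linarith) S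
    fun k hk => S.min'_le k hk
  calc (∑ k ∈ S, r ^ k) ^ q ≤ (r ^ S.min' hne * 2) ^ q := by
        refine Real.rpow_le_rpow (Finset.sum_nonneg fun _ _ => pow_nonneg h0.le _)
          (hle.trans ?_) hq.le
        gcongr
        rw [inv_le_comm₀ (by linarith) two_pos]
        linarith
    _ = 2 ^ q * (r ^ q) ^ S.min' hne := by
        rw [Real.mul_rpow (by positivity) (by positivity), mul_comm, ← Real.rpow_natCast,
          ← Real.rpow_natCast, ← Real.rpow_mul h0.le, ← Real.rpow_mul h0.le, mul_comm q]
    _ ≤ _ := by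
        gcongr
        exact Finset.single_le_sum (f := fun k => (r ^ q) ^ k) (fun _ _ => by positivity) hmin

/-! ### The decay rate -/

/-- The growth ratio of the contributions of the dyadic scales. -/
noncomputable def scaleRatio (d : ℕ) (p : ℝ) : ℝ := 2 ^ ((p - d) / (p - 1))

theorem scaleRatio_pos (d : ℕ) (p : ℝ) : 0 < scaleRatio d p := by
  unfold scaleRatio; positivity

theorem tailRate_nonneg (d : ℕ) (p : ℝ) {t : ℝ} (ht : 2 < t) : 0 ≤ tailRate d p t := by
  have : 0 < Real.log t := Real.log_pos (by linarith)
  unfold tailRate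
  split_ifs <;> positivity

/-- The geometric sum is of order `2 ^ (K (p - d) / (p - 1))`, exactly `K`, or bounded, in the cases
`d < p`, `d = p`, `d > p`. Since `2 ^ K ≤ t`, its power `p - 1` is then at most a constant times `t
^ (p - d)`, `(log t) ^ (d - 1)` or one. -/
theorem exists_tailRate_le (d : ℕ) {p : ℝ} (hp : 2 < p) :
    ∃ C : ℝ, 0 < C ∧ ∀ (t : ℝ) (K : ℕ), 2 < t → 2 ^ K ≤ t →
      tailRate d p t ≤ C * t ^ d ∧
      tailRate d p t * (∑ k ∈ Finset.range K, scaleRatio d p ^ k) ^ (p - 1) ≤ C * t ^ p := by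
  have hp1 : 0 < p - 1 := by linarith
  have hβ0 := scaleRatio_pos d p
  set β := scaleRatio d p with hβ
  rcases lt_trichotomy (d : ℝ) p with h | h | h
  · have hβ1 : 1 < β := by
      rw [hβ, scaleRatio]
      exact Real.one_lt_rpow one_lt_two (div_pos (by linarith) hp1)
    refine ⟨max 1 ((β - 1)⁻¹ ^ (p - 1)), by positivity, fun t K ht hK => ?_⟩
    have ht0 : 0 < t := by linarith
    have hβi : 0 ≤ (β - 1)⁻¹ := inv_nonneg.2 (by linarith)
    rw [tailRate, if_pos h]
    refine ⟨le_mul_of_one_le_left (by positivity) (le_max_left _ _), ?_⟩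
    have hS : ∑ k ∈ Finset.range K, β ^ k ≤ β ^ K * (β - 1)⁻¹ := by
      rw [geom_sum_eq hβ1.ne', ← div_eq_mul_inv]
      gcongr
      linarith
    have hβK : (β ^ K) ^ (p - 1) ≤ t ^ (p - d) := by
      have : (β ^ K) ^ (p - 1) = ((2 : ℝ) ^ K) ^ (p - d) := by
        rw [hβ, scaleRatio, ← Real.rpow_natCast, ← Real.rpow_natCast, ← Real.rpow_mul two_pos.le,
          ← Real.rpow_mul two_pos.le, ← Real.rpow_mul two_pos.le]
        congr 1
        field_simp
      rw [this]
      exact Real.rpow_le_rpow (by positivity) hK (by linarith)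
    calc t ^ d * (∑ k ∈ Finset.range K, β ^ k) ^ (p - 1)
        ≤ t ^ d * (β ^ K * (β - 1)⁻¹) ^ (p - 1) := by
          refine mul_le_mul_of_nonneg_left (Real.rpow_le_rpow ?_ hS hp1.le) (by positivity)
          exact Finset.sum_nonneg fun _ _ => by positivity
      _ = t ^ d * ((β ^ K) ^ (p - 1) * (β - 1)⁻¹ ^ (p - 1)) := by
          rw [Real.mul_rpow (by positivity) hβi]
      _ ≤ t ^ d * (t ^ (p - d) * max 1 ((β - 1)⁻¹ ^ (p - 1))) := by
          gcongr
          exact le_max_right _ _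
      _ = max 1 ((β - 1)⁻¹ ^ (p - 1)) * (t ^ (d : ℝ) * t ^ (p - d)) := by
          rw [Real.rpow_natCast]; ring
      _ = _ := by rw [← Real.rpow_add ht0]; congr 2; ring
  · have hβ1 : β = 1 := by rw [hβ, scaleRatio, h]; simp
    have hl2 : 0 < Real.log 2 := Real.log_pos one_lt_two
    refine ⟨(Real.log 2 ^ (d - 1))⁻¹, by positivity, fun t K ht hK => ?_⟩
    have ht0 : 0 < t := by linarith
    have hlt : Real.log 2 ≤ Real.log t := Real.log_le_log two_pos ht.le
    have hlt0 : 0 < Real.log t := hl2.trans_le hlt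
    rw [tailRate, if_neg h.not_lt, if_pos h, hβ1]
    have hd : p - 1 = ((d - 1 : ℕ) : ℝ) := by
      have : 1 ≤ d := by
        have : (2 : ℝ) < d := h ▸ hp
        have : 2 < d := by exact_mod_cast this
        omega
      rw [Nat.cast_sub this, h, Nat.cast_one]
    refine ⟨?_, ?_⟩
    · rw [div_eq_inv_mul]
      gcongr
    · simp only [one_pow, Finset.sum_const, Finset.card_range, nsmul_eq_mul, mul_one]
      rw [hd, Real.rpow_natCast, ← h, Real.rpow_natCast]
      have hK' : K * Real.log 2 ≤ Real.log t := by
        rw [← Real.log_pow]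
        exact Real.log_le_log (by positivity) hK
      have hK2 : (K : ℝ) ^ (d - 1) * Real.log 2 ^ (d - 1) ≤ Real.log t ^ (d - 1) := by
        rw [← mul_pow]
        gcongr
      rw [div_mul_eq_mul_div, div_le_iff₀ (by positivity), inv_mul_eq_div, div_mul_eq_mul_div,
        le_div_iff₀ (by positivity), mul_assoc]
      gcongr
  · have hβ1 : β < 1 := by
      rw [hβ, scaleRatio]
      exact Real.rpow_lt_one_of_one_lt_of_neg one_lt_two (div_neg_of_neg_of_pos (by linarith) hp1)
    have h1 : 0 < (1 - β)⁻¹ := inv_pos.2 (by linarith)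
    refine ⟨max 1 ((1 - β)⁻¹ ^ (p - 1)), by positivity, fun t K ht hK => ?_⟩
    have ht0 : 0 < t := by linarith
    rw [tailRate, if_neg h.le.not_gt, if_neg h.ne']
    refine ⟨?_, ?_⟩
    · refine le_trans ?_ (le_mul_of_one_le_left (by positivity) (le_max_left _ _))
      rw [← Real.rpow_natCast]
      exact Real.rpow_le_rpow_of_exponent_le (by linarith) h.le
    · rw [mul_comm]
      gcongr
      refine le_trans ?_ (le_max_right _ _)
      gcongr
      exact sum_range_pow_le hβ0.le hβ1 K

/-! ### Lower bounds from multiscale sums -/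

section Multiscale

variable {X : Type*} [Fintype X] {D : X → ℝ} {B : ℕ → Finset X} {κ : ℝ}

/-- Cauchy–Schwarz on `B k` bounds the term of scale `k` by a multiple of `2 ^ (-k (d - 2) / 2)`,
summable because `d ≥ 3`; the sum is comparable to its first term. -/
theorem sq_multiscale_sum_le (hD : ∀ x, 0 ≤ D x) {d : ℕ} (hd : 3 ≤ d) (hκ : 0 ≤ κ) {K : ℕ}
    (S : Finset ℕ) (hS : ∀ k ∈ S, K ≤ k) (hB : ∀ k ∈ S, ((B k).card : ℝ) ≤ κ * (2 ^ d) ^ k) :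
    (∑ k ∈ S, ((1 / 2) ^ (d - 1)) ^ k * ∑ x ∈ B k, D x) ^ 2 ≤
      16 * κ * (∑ x, D x ^ 2) * ((1 / 2 : ℝ) ^ (d - 2)) ^ K := by
  set E := ∑ x, D x ^ 2 with hE
  have hE0 : 0 ≤ E := Finset.sum_nonneg fun _ _ => sq_nonneg _
  set σ : ℝ := (1 / 2) ^ (d - 2) with hσ
  have hσ0 : 0 ≤ σ := by positivity
  have hσ1 : σ ≤ 1 / 2 := by
    calc σ ≤ (1 / 2) ^ 1 := pow_le_pow_of_le_one (by norm_num) (by norm_num) (by omega)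
      _ = 1 / 2 := pow_one _
  -- This makes the geometric factor at most `4`, whose square is the constant `16`.
  have hsq : √σ ≤ 3 / 4 := by
    rw [Real.sqrt_le_left (by norm_num)]
    linarith
  have hterm : ∀ k ∈ S, ((1 / 2) ^ (d - 1)) ^ k * ∑ x ∈ B k, D x ≤ √(κ * E) * √σ ^ k := by
    intro k hk
    have hsum0 : 0 ≤ ∑ x ∈ B k, D x := Finset.sum_nonneg fun _ _ => hD _
    refine (sq_le_sq₀ (by positivity) (by positivity)).1 ?_
    rw [mul_pow, mul_pow, Real.sq_sqrt (by positivity), ← pow_mul (√σ), mul_comm k 2, pow_mul (√σ),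
      Real.sq_sqrt hσ0]
    calc (((1 / 2 : ℝ) ^ (d - 1)) ^ k) ^ 2 * (∑ x ∈ B k, D x) ^ 2
        ≤ (((1 / 2 : ℝ) ^ (d - 1)) ^ k) ^ 2 * (((B k).card : ℝ) * ∑ x ∈ B k, D x ^ 2) := by
          gcongr
          exact sq_sum_le_card_mul_sum_sq
      _ ≤ (((1 / 2 : ℝ) ^ (d - 1)) ^ k) ^ 2 * ((κ * (2 ^ d) ^ k) * E) := by
          gcongr
          · exact hB k hk
          · exact Finset.sum_le_sum_of_subset_of_nonneg (Finset.subset_univ _)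
              fun _ _ _ => sq_nonneg _
      _ = κ * E * (((1 / 2 : ℝ) ^ (d - 1)) ^ 2 * 2 ^ d) ^ k := by
          rw [mul_pow _ _ k, ← pow_mul, ← pow_mul _ 2 k, mul_comm 2 k]; ring
      _ = κ * E * σ ^ k := by
          congr 2
          obtain ⟨e, rfl⟩ : ∃ e, d = e + 2 := ⟨d - 2, by omega⟩
          rw [hσ, show e + 2 - 1 = e + 1 by omega, Nat.add_sub_cancel]
          simp only [one_div, inv_pow]
          field_simp
          ring
  have hsum : ∑ k ∈ S, ((1 / 2) ^ (d - 1)) ^ k * ∑ x ∈ B k, D x ≤ √(κ * E) * (√σ ^ K * 4) := by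
    refine (Finset.sum_le_sum hterm).trans ?_
    rw [← Finset.mul_sum]
    gcongr
    refine (sum_pow_le_of_forall_le (Real.sqrt_nonneg _) (by linarith) S hS).trans ?_
    gcongr
    rw [inv_le_comm₀ (by linarith) (by norm_num)]
    linarith
  calc _ ≤ (√(κ * E) * (√σ ^ K * 4)) ^ 2 := by
        refine pow_le_pow_left₀ (Finset.sum_nonneg fun k _ => ?_) hsum 2
        exact mul_nonneg (by positivity) (Finset.sum_nonneg fun _ _ => hD _)
    _ = √(κ * E) ^ 2 * (√σ ^ 2) ^ K * 16 := by ring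
    _ = _ := by
        rw [Real.sq_sqrt (by positivity), Real.sq_sqrt hσ0]; ring

/-- Exchanging the sums gives each point `x` the weight `θ x`, the sum of `r ^ k` over the scales
whose set contains `x`. Hölder pairs `θ` with `D`, and the `q`-norm of `θ` is computed scale by
scale. -/
theorem rpow_multiscale_sum_le (hD : ∀ x, 0 ≤ D x) {d : ℕ} (hd : 3 ≤ d) {p : ℝ} (hp : 2 < p)
    (hκ : 0 ≤ κ) {K : ℕ} (S : Finset ℕ) (hS : ∀ k ∈ S, k < K)
    (hB : ∀ k ∈ S, ((B k).card : ℝ) ≤ κ * (2 ^ d) ^ k) :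
    (∑ k ∈ S, ((1 / 2) ^ (d - 1)) ^ k * ∑ x ∈ B k, D x) ^ p ≤
      (2 ^ (p / (p - 1)) * κ) ^ (p - 1) *
        (∑ k ∈ Finset.range K, scaleRatio d p ^ k) ^ (p - 1) * ∑ x, D x ^ p := by
  classical
  have hp0 : 0 < p := by linarith
  have hp1 : 0 < p - 1 := by linarith
  set q := p / (p - 1) with hq
  have hq0 : 0 < q := by positivity
  have hqp : q.HolderConjugate p := by
    rw [Real.holderConjugate_comm]
    exact Real.HolderConjugate.conjExponent (by linarith)
  set r : ℝ := (1 / 2) ^ (d - 1) with hr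
  have hr0 : 0 < r := by positivity
  have hr1 : r ≤ 1 / 2 := by
    calc r ≤ (1 / 2) ^ 1 := pow_le_pow_of_le_one (by norm_num) (by norm_num) (by omega)
      _ = 1 / 2 := pow_one _
  set β := scaleRatio d p with hβ
  have hβ0 : 0 < β := scaleRatio_pos d p
  -- The definition of `scaleRatio` comes from here: the exponents satisfy `d - (d - 1) p / (p - 1)
  -- = (p - d) / (p - 1)`.
  have hrβ : r ^ q * 2 ^ d = β := by
    have hr2 : r = (2 : ℝ) ^ (-((d : ℝ) - 1)) := by
      have hd1 : (d : ℝ) - 1 = ((d - 1 : ℕ) : ℝ) := by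
        rw [Nat.cast_sub (by omega), Nat.cast_one]
      rw [hr, Real.rpow_neg two_pos.le, hd1, Real.rpow_natCast, one_div, inv_pow]
    rw [hr2, ← Real.rpow_mul two_pos.le, ← Real.rpow_natCast, ← Real.rpow_add two_pos, hβ,
      scaleRatio, hq]
    congr 1
    field_simp
    ring
  let θ : X → ℝ := fun x => ∑ k ∈ S with x ∈ B k, r ^ k
  have hθ0 : ∀ x, 0 ≤ θ x := fun x => Finset.sum_nonneg fun _ _ => by positivity
  have hswap : ∑ k ∈ S, r ^ k * ∑ x ∈ B k, D x = ∑ x, θ x * D x := by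
    simp only [θ, Finset.sum_mul, Finset.mul_sum, Finset.sum_filter]
    rw [Finset.sum_comm]
    refine Finset.sum_congr rfl fun k _ => ?_
    simp [ite_mul, Finset.sum_ite_mem]
  have hθq : ∑ x, θ x ^ q ≤ 2 ^ q * κ * ∑ k ∈ Finset.range K, β ^ k := by
    calc ∑ x, θ x ^ q ≤ ∑ x, 2 ^ q * ∑ k ∈ S with x ∈ B k, (r ^ q) ^ k :=
          Finset.sum_le_sum fun x _ => rpow_sum_pow_le hr0 hr1 hq0 _
      _ = 2 ^ q * ∑ k ∈ S, ((B k).card : ℝ) * (r ^ q) ^ k := by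
          rw [← Finset.mul_sum]
          congr 1
          simp only [Finset.sum_filter]
          rw [Finset.sum_comm]
          refine Finset.sum_congr rfl fun k _ => ?_
          simp [Finset.sum_ite_mem]
      _ ≤ 2 ^ q * ∑ k ∈ S, κ * β ^ k := by
          refine mul_le_mul_of_nonneg_left (Finset.sum_le_sum fun k hk => ?_) (by positivity)
          calc ((B k).card : ℝ) * (r ^ q) ^ k ≤ κ * (2 ^ d) ^ k * (r ^ q) ^ k := by
                gcongr
                exact hB k hk
            _ = κ * β ^ k := by rw [← hrβ, mul_pow]; ring
      _ ≤ 2 ^ q * ∑ k ∈ Finset.range K, κ * β ^ k := by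
          refine mul_le_mul_of_nonneg_left ?_ (by positivity)
          exact Finset.sum_le_sum_of_subset_of_nonneg
            (fun k hk => Finset.mem_range.2 (hS k hk)) fun _ _ _ => by positivity
      _ = _ := by rw [← Finset.mul_sum]; ring
  have hDp : 0 ≤ ∑ x, D x ^ p := Finset.sum_nonneg fun x _ => Real.rpow_nonneg (hD x) _
  have hholder := Real.inner_le_Lp_mul_Lq_of_nonneg Finset.univ hqp (fun x _ => hθ0 x)
    (fun x _ => hD x)
  rw [hswap]
  have hθq0 : 0 ≤ ∑ x, θ x ^ q := Finset.sum_nonneg fun x _ => Real.rpow_nonneg (hθ0 x) _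
  calc (∑ x, θ x * D x) ^ p
      ≤ ((∑ x, θ x ^ q) ^ (1 / q) * (∑ x, D x ^ p) ^ (1 / p)) ^ p := by
        refine Real.rpow_le_rpow (Finset.sum_nonneg fun x _ => mul_nonneg (hθ0 x) (hD x))
          hholder hp0.le
    _ = (∑ x, θ x ^ q) ^ (p - 1) * ∑ x, D x ^ p := by
        have hqp1 : 1 / q * p = p - 1 := by rw [hq]; field_simp
        rw [Real.mul_rpow (Real.rpow_nonneg hθq0 _) (Real.rpow_nonneg hDp _),
          ← Real.rpow_mul hθq0, ← Real.rpow_mul hDp, one_div_mul_cancel hp0.ne', Real.rpow_one,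
          hqp1]
    _ ≤ (2 ^ q * κ * ∑ k ∈ Finset.range K, β ^ k) ^ (p - 1) * ∑ x, D x ^ p := by
        exact mul_le_mul_of_nonneg_right (Real.rpow_le_rpow hθq0 hθq hp1.le) hDp
    _ = _ := by
        rw [Real.mul_rpow (by positivity) (Finset.sum_nonneg fun _ _ => by positivity)]

end Multiscale

/-- A height bounded by a multiscale sum of gradients forces a large energy. -/
theorem exists_tailRate_le_of_multiscale {d : ℕ} (hd : 3 ≤ d) {p : ℝ} (hp : 2 < p) {κ : ℝ}
    (hκ : 0 < κ) :
    ∃ c : ℝ, 0 < c ∧ ∀ (X : Type) [Fintype X] (D : X → ℝ) (B : ℕ → Finset X) (M : ℕ) (t : ℝ),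
      (∀ x, 0 ≤ D x) → (∀ k ≤ M, ((B k).card : ℝ) ≤ κ * (2 ^ d) ^ k) → 2 < t →
      t ≤ κ * ∑ k ∈ Finset.range (M + 1), ((1 / 2) ^ (d - 1)) ^ k * ∑ x ∈ B k, D x →
      c * tailRate d p t ≤ ∑ x, (D x ^ p + D x ^ 2) := by
  obtain ⟨C, hC, hrate⟩ := exists_tailRate_le d hp
  have hp0 : 0 < p := by linarith
  set C₁ : ℝ := 64 * κ ^ 3 * 2 ^ (d - 2) with hC₁
  set C₂ : ℝ := (2 * κ) ^ p * (2 ^ (p / (p - 1)) * κ) ^ (p - 1) with hC₂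
  have hC₁0 : 0 < C₁ := by positivity
  have hC₂0 : 0 < C₂ := by positivity
  refine ⟨(C * (C₁ + C₂))⁻¹, by positivity, fun X _ D B M t hD hB ht hle => ?_⟩
  -- The critical scale, `2 ^ K ≤ t < 2 ^ (K + 1)`: the lower bound on `t` serves the fine scales,
  -- the upper bound the coarse ones.
  obtain ⟨K, hK, hK'⟩ := exists_nat_pow_near (by linarith : (1 : ℝ) ≤ t) one_lt_two
  obtain ⟨hr1, hr2⟩ := hrate t K ht hK
  have hR0 := tailRate_nonneg d p ht
  have ht0 : 0 < t := by linarith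
  set E₂ := ∑ x, D x ^ 2 with hE₂
  set Eₚ := ∑ x, D x ^ p with hEₚ
  have hE₂0 : 0 ≤ E₂ := Finset.sum_nonneg fun _ _ => sq_nonneg _
  have hEₚ0 : 0 ≤ Eₚ := Finset.sum_nonneg fun x _ => Real.rpow_nonneg (hD x) _
  rw [Finset.sum_add_distrib, inv_mul_le_iff₀ (by positivity)]
  set a : ℕ → ℝ := fun k => ((1 / 2) ^ (d - 1)) ^ k * ∑ x ∈ B k, D x with ha
  set S₁ := {k ∈ Finset.range (M + 1) | k < K} with hS₁
  set S₂ := {k ∈ Finset.range (M + 1) | ¬ k < K} with hS₂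
  have hmem : ∀ k ∈ Finset.range (M + 1), ((B k).card : ℝ) ≤ κ * (2 ^ d) ^ k := fun k hk =>
    hB k (Nat.lt_succ_iff.1 (Finset.mem_range.1 hk))
  have hlow := rpow_multiscale_sum_le hD hd hp hκ.le S₁ (fun k hk => (Finset.mem_filter.1 hk).2)
    fun k hk => hmem k (Finset.mem_filter.1 hk).1
  have hhigh := sq_multiscale_sum_le hD hd hκ.le S₂
    (fun k hk => not_lt.1 (Finset.mem_filter.1 hk).2) fun k hk => hmem k (Finset.mem_filter.1 hk).1
  rw [← Finset.sum_filter_add_sum_filter_not (Finset.range (M + 1)) (fun k => k < K)] at hle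
  change t ≤ κ * (∑ k ∈ S₁, a k + ∑ k ∈ S₂, a k) at hle
  change (∑ k ∈ S₁, a k) ^ p ≤ _ at hlow
  change (∑ k ∈ S₂, a k) ^ 2 ≤ _ at hhigh
  -- The larger of the two partial sums carries at least half of the height.
  rcases le_total (∑ k ∈ S₁, a k) (∑ k ∈ S₂, a k) with h | h
  · have h1 : t ≤ 2 * κ * ∑ k ∈ S₂, a k := by nlinarith
    have h2 : t ^ 2 ≤ (2 * κ) ^ 2 * (16 * κ * E₂ * ((1 / 2 : ℝ) ^ (d - 2)) ^ K) := by
      calc t ^ 2 ≤ (2 * κ * ∑ k ∈ S₂, a k) ^ 2 := by gcongr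
        _ = (2 * κ) ^ 2 * (∑ k ∈ S₂, a k) ^ 2 := by ring
        _ ≤ _ := by gcongr
    have h3 : t ^ (d - 2) * ((1 / 2 : ℝ) ^ (d - 2)) ^ K ≤ 2 ^ (d - 2) := by
      rw [← pow_mul, mul_comm (d - 2) K, pow_mul, ← mul_pow]
      gcongr
      rw [one_div, inv_pow, ← div_eq_mul_inv, div_le_iff₀ (by positivity), ← pow_succ']
      exact hK'.le
    have h4 : t ^ d ≤ C₁ * E₂ := by
      calc t ^ d = t ^ (d - 2) * t ^ 2 := by rw [← pow_add]; congr 1; omega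
        _ ≤ t ^ (d - 2) * ((2 * κ) ^ 2 * (16 * κ * E₂ * ((1 / 2 : ℝ) ^ (d - 2)) ^ K)) := by gcongr
        _ = (64 * κ ^ 3 * E₂) * (t ^ (d - 2) * ((1 / 2 : ℝ) ^ (d - 2)) ^ K) := by ring
        _ ≤ (64 * κ ^ 3 * E₂) * 2 ^ (d - 2) := by gcongr
        _ = _ := by rw [hC₁]; ring
    calc tailRate d p t ≤ C * t ^ d := hr1
      _ ≤ C * (C₁ * E₂) := by gcongr
      _ = C * C₁ * E₂ := by ring
      _ ≤ C * (C₁ + C₂) * (Eₚ + E₂) := by gcongr <;> linarith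
  · have h1 : t ≤ 2 * κ * ∑ k ∈ S₁, a k := by nlinarith
    have hsum0 : 0 ≤ ∑ k ∈ S₁, a k := Finset.sum_nonneg fun k _ =>
      mul_nonneg (by positivity) (Finset.sum_nonneg fun x _ => hD x)
    set s := ∑ k ∈ Finset.range K, scaleRatio d p ^ k with hs
    have hs0 : 0 ≤ s := Finset.sum_nonneg fun _ _ => (pow_pos (scaleRatio_pos d p) _).le
    have h2 : t ^ p ≤ C₂ * s ^ (p - 1) * Eₚ := by
      calc t ^ p ≤ (2 * κ * ∑ k ∈ S₁, a k) ^ p := Real.rpow_le_rpow ht0.le h1 hp0.le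
        _ = (2 * κ) ^ p * (∑ k ∈ S₁, a k) ^ p := Real.mul_rpow (by positivity) hsum0
        _ ≤ (2 * κ) ^ p * _ := mul_le_mul_of_nonneg_left hlow (by positivity)
        _ = _ := by rw [hC₂]; ring
    have htp : 0 < t ^ p := Real.rpow_pos_of_pos ht0 p
    have h3 : tailRate d p t * t ^ p ≤ C * C₂ * Eₚ * t ^ p := by
      calc tailRate d p t * t ^ p ≤ tailRate d p t * (C₂ * s ^ (p - 1) * Eₚ) := by gcongr
        _ = (tailRate d p t * s ^ (p - 1)) * (C₂ * Eₚ) := by ring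
        _ ≤ (C * t ^ p) * (C₂ * Eₚ) := by gcongr
        _ = _ := by ring
    calc tailRate d p t ≤ C * C₂ * Eₚ := le_of_mul_le_mul_right h3 htp
      _ ≤ C * (C₁ + C₂) * (Eₚ + E₂) := by gcongr <;> linarith

/-! ### Averages over dyadic cubes -/

section Cube

variable {d : ℕ}

/-- The discrete cube `{0, …, m - 1}^d`. -/
def cube (d m : ℕ) : Finset (Fin d → ℕ) := Fintype.piFinset fun _ => Finset.range m

theorem mem_cube {m : ℕ} {y : Fin d → ℕ} : y ∈ cube d m ↔ ∀ i, y i < m := by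
  simp [cube]

theorem card_cube (d m : ℕ) : (cube d m).card = m ^ d := by
  simp [cube]

theorem abs_sub_le_of_forall_step (h : (Fin d → ℕ) → ℝ) (D : ℝ) (b : Fin d → ℕ)
    (hstep : ∀ x i, x + Pi.single i 1 ≤ b → |h (x + Pi.single i 1) - h x| ≤ D) :
    |h b - h 0| ≤ (∑ i, b i : ℕ) * D := by
  induction hN : ∑ i, b i generalizing b with
  | zero =>
    have : b = 0 := by
      ext i
      exact (Finset.sum_eq_zero_iff.1 hN) i (Finset.mem_univ i)
    simp [this]
  | succ N ih =>
    obtain ⟨i, hi⟩ : ∃ i, b i ≠ 0 := by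
      by_contra! hcon
      simp [hcon] at hN
    set b' := Function.update b i (b i - 1) with hb'
    have hb : b = b' + Pi.single i 1 := by
      ext j
      by_cases hj : j = i
      · subst hj
        simp only [hb', Pi.add_apply, Function.update_self, Pi.single_eq_same]
        omega
      · simp [hb', hj]
    have hle : b' ≤ b := by
      rw [hb]
      exact le_self_add
    have hsum : ∑ j, b' j = N := by
      have : ∑ j, b j = ∑ j, b' j + 1 := by
        conv_lhs => rw [hb]
        simp [Finset.sum_add_distrib]
      omega
    have h1 := ih b' (fun x j hx => hstep x j (hx.trans hle)) hsum
    have h2 := hstep b' i hb.ge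
    rw [← hb] at h2
    calc |h b - h 0| ≤ |h b - h b'| + |h b' - h 0| := abs_sub_le _ _ _
      _ ≤ D + N * D := add_le_add h2 h1
      _ = _ := by push_cast; ring

/-- The sum of the absolute values of the forward differences. -/
def gradSum {A : Type*} [AddMonoidWithOne A] (g : (Fin d → A) → ℝ) (y : Fin d → A) : ℝ :=
  ∑ i, |g (y + Pi.single i 1) - g y|

theorem gradSum_nonneg {A : Type*} [AddMonoidWithOne A] (g : (Fin d → A) → ℝ) (y : Fin d → A) :
    0 ≤ gradSum g y :=
  Finset.sum_nonneg fun _ _ => abs_nonneg _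

theorem abs_sub_le_gradSum {A : Type*} [AddMonoidWithOne A] (g : (Fin d → A) → ℝ)
    (y : Fin d → A) (i : Fin d) : |g (y + Pi.single i 1) - g y| ≤ gradSum g y :=
  Finset.single_le_sum (f := fun i => |g (y + Pi.single i 1) - g y|)
    (fun _ _ => abs_nonneg _) (Finset.mem_univ i)

/-- The cube is moved by unit steps, at most `d * m` of them. Each step costs at most the gradient
sum over the cube's current position, which stays inside the cube of side `2 * m`. -/
theorem abs_sum_cube_shift_sub_le (g : (Fin d → ℕ) → ℝ) {m : ℕ} (b : Fin d → ℕ)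
    (hb : ∀ i, b i ≤ m) :
    |∑ a ∈ cube d m, g (b + a) - ∑ a ∈ cube d m, g a| ≤
      d * m * ∑ y ∈ cube d (2 * m), gradSum g y := by
  have hT : 0 ≤ ∑ y ∈ cube d (2 * m), gradSum g y :=
    Finset.sum_nonneg fun y _ => gradSum_nonneg g y
  have := abs_sub_le_of_forall_step (fun x => ∑ a ∈ cube d m, g (x + a))
    (∑ y ∈ cube d (2 * m), gradSum g y) b fun x i hx => ?_
  · simp only [zero_add] at this
    refine this.trans (mul_le_mul_of_nonneg_right ?_ hT)
    have hsum : ∑ i, b i ≤ d * m := by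
      calc ∑ i, b i ≤ ∑ _i : Fin d, m := Finset.sum_le_sum fun i _ => hb i
        _ = d * m := by simp
    exact_mod_cast hsum
  · rw [← Finset.sum_sub_distrib]
    calc |∑ a ∈ cube d m, (g (x + Pi.single i 1 + a) - g (x + a))|
        ≤ ∑ a ∈ cube d m, |g (x + Pi.single i 1 + a) - g (x + a)| := Finset.abs_sum_le_sum_abs _ _
      _ ≤ ∑ a ∈ cube d m, gradSum g (x + a) := Finset.sum_le_sum fun a _ => by
          rw [add_right_comm]
          exact abs_sub_le_gradSum g _ i
      _ = ∑ y ∈ (cube d m).map (addLeftEmbedding x), gradSum g y := by simp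
      _ ≤ _ := by
          refine Finset.sum_le_sum_of_subset_of_nonneg (fun y hy => ?_)
            fun y _ _ => gradSum_nonneg g y
          obtain ⟨a, ha, rfl⟩ := Finset.mem_map.1 hy
          refine mem_cube.2 fun j => ?_
          have h1 := mem_cube.1 ha j
          have h2 : x j ≤ b j := (le_self_add.trans hx) j
          have h3 := hb j
          simp only [addLeftEmbedding_apply, Pi.add_apply]
          omega

theorem sum_cube_two_mul (g : (Fin d → ℕ) → ℝ) {m : ℕ} (hm : 0 < m) :
    ∑ y ∈ cube d (2 * m), g y = ∑ ε ∈ cube d 2, ∑ a ∈ cube d m, g (m • ε + a) := by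
  rw [← Finset.sum_product']
  refine Finset.sum_nbij' (fun y => (fun i => y i / m, fun i => y i % m))
    (fun z => m • z.1 + z.2) ?_ ?_ ?_ ?_ ?_
  · intro y hy
    rw [mem_cube] at hy
    refine Finset.mem_product.2 ⟨mem_cube.2 fun i => ?_, mem_cube.2 fun i => Nat.mod_lt _ hm⟩
    exact (Nat.div_lt_iff_lt_mul hm).2 (hy i)
  · rintro ⟨ε, a⟩ hz
    obtain ⟨h1, h2⟩ := Finset.mem_product.1 hz
    refine mem_cube.2 fun i => ?_
    have h1 := mem_cube.1 h1 i
    have h2 := mem_cube.1 h2 i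
    simp only [Pi.add_apply, Pi.smul_apply, smul_eq_mul] at h1 h2 ⊢
    nlinarith
  · intro y _
    ext i
    simp [Nat.div_add_mod]
  · rintro ⟨ε, a⟩ hz
    obtain ⟨-, h2⟩ := Finset.mem_product.1 hz
    refine Prod.ext (funext fun i => ?_) (funext fun i => ?_)
    · have h2 := mem_cube.1 h2 i
      simp only [Pi.add_apply, Pi.smul_apply, smul_eq_mul] at h2 ⊢
      rw [Nat.mul_add_div hm, Nat.div_eq_of_lt h2, add_zero]
    · have h2 := mem_cube.1 h2 i
      simp only [Pi.add_apply, Pi.smul_apply, smul_eq_mul] at h2 ⊢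
      rw [Nat.mul_add_mod, Nat.mod_eq_of_lt h2]
  · intro y _
    congr 1
    ext i
    simp [Nat.div_add_mod]

theorem abs_sum_cube_two_mul_sub_le (g : (Fin d → ℕ) → ℝ) {m : ℕ} (hm : 0 < m) :
    |∑ y ∈ cube d (2 * m), g y - 2 ^ d * ∑ a ∈ cube d m, g a| ≤
      2 ^ d * (d * m * ∑ y ∈ cube d (2 * m), gradSum g y) := by
  have hcard : ((cube d 2).card : ℝ) = 2 ^ d := by rw [card_cube]; push_cast; rfl
  rw [sum_cube_two_mul g hm, ← hcard, ← nsmul_eq_mul, ← nsmul_eq_mul, ← Finset.sum_const,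
    ← Finset.sum_const, ← Finset.sum_sub_distrib]
  refine (Finset.abs_sum_le_sum_abs _ _).trans (Finset.sum_le_sum fun ε hε => ?_)
  refine abs_sum_cube_shift_sub_le g _ fun i => ?_
  have := mem_cube.1 hε i
  simp only [Pi.smul_apply, smul_eq_mul]
  nlinarith

/-- The average over the dyadic cube of side `2 ^ k`. -/
noncomputable def cubeAverage (g : (Fin d → ℕ) → ℝ) (k : ℕ) : ℝ :=
  ((2 ^ k) ^ d)⁻¹ * ∑ y ∈ cube d (2 ^ k), g y

/-- The cube of side `2 ^ (k + 1)` is a union of `2 ^ d` translates of the smaller one. Normalising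
by the volume, the path length `d * 2 ^ k` cancels one factor of the side and leaves the exponent `d
- 1`. -/
theorem abs_cubeAverage_succ_sub_le (hd : 1 ≤ d) (g : (Fin d → ℕ) → ℝ) (k : ℕ) :
    |cubeAverage g (k + 1) - cubeAverage g k| ≤
      d * 2 ^ d * (((1 / 2) ^ (d - 1)) ^ (k + 1) * ∑ y ∈ cube d (2 ^ (k + 1)), gradSum g y) := by
  have h := abs_sum_cube_two_mul_sub_le g (m := 2 ^ k) (by positivity)
  rw [← pow_succ'] at h
  set T := ∑ y ∈ cube d (2 ^ (k + 1)), gradSum g y with hT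
  have hT0 : 0 ≤ T := Finset.sum_nonneg fun y _ => gradSum_nonneg g y
  have hpos : (0 : ℝ) < ((2 ^ (k + 1)) ^ d)⁻¹ := by positivity
  have heq : cubeAverage g (k + 1) - cubeAverage g k = ((2 ^ (k + 1)) ^ d)⁻¹ *
      (∑ y ∈ cube d (2 ^ (k + 1)), g y - 2 ^ d * ∑ a ∈ cube d (2 ^ k), g a) := by
    unfold cubeAverage
    rw [pow_succ (2 : ℝ) k, mul_pow, mul_inv]
    field_simp
  rw [heq, abs_mul, abs_of_pos hpos]
  refine (mul_le_mul_of_nonneg_left h hpos.le).trans ?_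
  obtain ⟨e, rfl⟩ : ∃ e, d = e + 1 := ⟨d - 1, by omega⟩
  rw [Nat.add_sub_cancel, one_div, inv_pow, inv_pow, ← pow_mul, ← pow_mul, mul_comm e,
    mul_add (k + 1), mul_one, pow_add]
  push_cast
  have h2 : (0 : ℝ) < 2 ^ ((k + 1) * e) := by positivity
  have h3 : (2 : ℝ) ^ (k + 1) = 2 * 2 ^ k := pow_succ' 2 k
  rw [h3, mul_inv, mul_inv]
  have h4 : (2 : ℝ) ^ k * (2 ^ k)⁻¹ = 1 := mul_inv_cancel₀ (by positivity)
  have hnn : 0 ≤ ((2 : ℝ) ^ ((k + 1) * e))⁻¹ * 2 ^ (e + 1) * (((e : ℝ) + 1) * T) := by positivity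
  calc ((2 : ℝ) ^ ((k + 1) * e))⁻¹ * (2⁻¹ * (2 ^ k)⁻¹) * (2 ^ (e + 1) * ((e + 1) * 2 ^ k * T))
      = 2⁻¹ * (((2 : ℝ) ^ k * (2 ^ k)⁻¹) *
        (((2 : ℝ) ^ ((k + 1) * e))⁻¹ * 2 ^ (e + 1) * (((e : ℝ) + 1) * T))) := by ring
    _ ≤ ((2 : ℝ) ^ ((k + 1) * e))⁻¹ * 2 ^ (e + 1) * (((e : ℝ) + 1) * T) := by
        rw [h4, one_mul]; linarith
    _ = _ := by ring

theorem cubeAverage_zero (g : (Fin d → ℕ) → ℝ) : cubeAverage g 0 = g 0 := by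
  have : cube d (2 ^ 0) = {0} := by
    ext y
    rw [mem_cube, Finset.mem_singleton, funext_iff]
    simp
  rw [cubeAverage, this]
  simp

theorem abs_cubeAverage_sub_le (hd : 1 ≤ d) (g : (Fin d → ℕ) → ℝ) (M : ℕ) :
    |cubeAverage g M - g 0| ≤ d * 2 ^ d * ∑ k ∈ Finset.range (M + 1),
      ((1 / 2) ^ (d - 1)) ^ k * ∑ y ∈ cube d (2 ^ k), gradSum g y := by
  have hterm : ∀ k, 0 ≤ ((1 / 2 : ℝ) ^ (d - 1)) ^ k * ∑ y ∈ cube d (2 ^ k), gradSum g y :=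
    fun k => mul_nonneg (by positivity) (Finset.sum_nonneg fun y _ => gradSum_nonneg g y)
  induction M with
  | zero =>
    rw [cubeAverage_zero, sub_self, abs_zero]
    exact mul_nonneg (by positivity) (Finset.sum_nonneg fun k _ => hterm k)
  | succ M ih =>
    rw [Finset.sum_range_succ, mul_add, add_comm (_ * _) (_ * _)]
    calc |cubeAverage g (M + 1) - g 0|
        ≤ |cubeAverage g (M + 1) - cubeAverage g M| + |cubeAverage g M - g 0| := abs_sub_le _ _ _
      _ ≤ _ := add_le_add (abs_cubeAverage_succ_sub_le hd g M) ih

end Cube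

/-! ### Functions on the discrete torus -/

section Torus

variable {d n : ℕ}

/-- The reduction of a lattice vector modulo `n`. -/
def torusCast (d n : ℕ) (y : Fin d → ℕ) : Fin d → ZMod n := fun i => (y i : ZMod n)

theorem torusCast_add (y z : Fin d → ℕ) :
    torusCast d n (y + z) = torusCast d n y + torusCast d n z := by
  ext i; simp [torusCast]

theorem torusCast_single (i : Fin d) : torusCast d n (Pi.single i 1) = Pi.single i 1 := by
  ext j
  by_cases h : j = i
  · subst h; simp [torusCast]
  · simp [torusCast, h]

theorem torusCast_zero : torusCast d n 0 = 0 := by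
  ext i; simp [torusCast]

theorem torusCast_val [NeZero n] (x : Fin d → ZMod n) : torusCast d n (fun i => (x i).val) = x := by
  ext i; simp [torusCast]

/-- Cubes no wider than the torus do not overlap themselves, so unrolled sums become sums over torus
sets without multiplicity. -/
theorem injOn_torusCast {m : ℕ} (hm : m ≤ n) :
    Set.InjOn (torusCast d n) (cube d m : Set (Fin d → ℕ)) := by
  intro y hy z hz h
  ext i
  have hy := mem_cube.1 (Finset.mem_coe.1 hy) i
  have hz := mem_cube.1 (Finset.mem_coe.1 hz) i
  have h := (ZMod.natCast_eq_natCast_iff' _ _ _).1 (congrFun h i)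
  rwa [Nat.mod_eq_of_lt (hy.trans_le hm), Nat.mod_eq_of_lt (hz.trans_le hm)] at h

/-- The function on `ℕ ^ d` obtained by unrolling a function on the torus, starting from `w`. -/
def unroll (ψ : (Fin d → ZMod n) → ℝ) (w : Fin d → ZMod n) (y : Fin d → ℕ) : ℝ :=
  ψ (w + torusCast d n y)

theorem unroll_zero (ψ : (Fin d → ZMod n) → ℝ) (w : Fin d → ZMod n) : unroll ψ w 0 = ψ w := by
  simp [unroll, torusCast_zero]

theorem gradSum_unroll (ψ : (Fin d → ZMod n) → ℝ) (w : Fin d → ZMod n) (y : Fin d → ℕ) :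
    gradSum (unroll ψ w) y = gradSum ψ (w + torusCast d n y) := by
  simp only [gradSum, unroll, torusCast_add, torusCast_single, add_assoc]

/-- The image of a cube in the torus. -/
def torusCube (n m : ℕ) (w : Fin d → ZMod n) : Finset (Fin d → ZMod n) :=
  (cube d m).image fun y => w + torusCast d n y

theorem card_torusCube_le (m : ℕ) (w : Fin d → ZMod n) : (torusCube n m w).card ≤ m ^ d :=
  Finset.card_image_le.trans (card_cube d m).le

theorem sum_cube_eq_sum_torusCube {m : ℕ} (hm : m ≤ n) (w : Fin d → ZMod n)
    (f : (Fin d → ZMod n) → ℝ) :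
    ∑ y ∈ cube d m, f (w + torusCast d n y) = ∑ x ∈ torusCube n m w, f x := by
  rw [torusCube, Finset.sum_image]
  intro y hy z hz h
  exact injOn_torusCast hm hy hz (add_left_cancel h)

theorem abs_cubeAverage_unroll_le (hd : 1 ≤ d) (ψ : (Fin d → ZMod n) → ℝ) {M : ℕ}
    (hM : 2 ^ M ≤ n) (w : Fin d → ZMod n) :
    |cubeAverage (unroll ψ w) M - ψ w| ≤ d * 2 ^ d * ∑ k ∈ Finset.range (M + 1),
      ((1 / 2) ^ (d - 1)) ^ k * ∑ x ∈ torusCube n (2 ^ k) w, gradSum ψ x := by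
  have h := abs_cubeAverage_sub_le hd (unroll ψ w) M
  rw [unroll_zero] at h
  refine h.trans_eq ?_
  congr 1
  refine Finset.sum_congr rfl fun k hk => ?_
  have hk : 2 ^ k ≤ n :=
    (Nat.pow_le_pow_right two_pos (Nat.lt_succ_iff.1 (Finset.mem_range.1 hk))).trans hM
  rw [← sum_cube_eq_sum_torusCube hk]
  simp only [gradSum_unroll]

variable [NeZero n]

theorem sum_val_le (x : Fin d → ZMod n) : ∑ i, (x i).val ≤ d * n := by
  calc ∑ i, (x i).val ≤ ∑ _i : Fin d, n := Finset.sum_le_sum fun i _ => (ZMod.val_lt (x i)).le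
    _ = d * n := by simp

theorem abs_torus_sub_le (f : (Fin d → ZMod n) → ℝ) {D : ℝ} (hD : 0 ≤ D)
    (h : ∀ x i, |f (x + Pi.single i 1) - f x| ≤ D) (v : Fin d → ZMod n) :
    |f v - f 0| ≤ d * n * D := by
  have := abs_sub_le_of_forall_step (fun b => f (torusCast d n b)) D (fun i => (v i).val)
    fun x i _ => by simpa only [torusCast_add, torusCast_single] using h (torusCast d n x) i
  simp only [torusCast_val, torusCast_zero] at this
  refine this.trans (mul_le_mul_of_nonneg_right ?_ hD)
  exact_mod_cast sum_val_le v

/-- At the top scale the cube is carried from the origin to `v` in at most `d * n` unit steps, each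
costing at most the gradient sum over the whole torus; `n` is comparable to the side of the cube. -/
theorem abs_cubeAverage_unroll_sub_le (hd : 1 ≤ d) (ψ : (Fin d → ZMod n) → ℝ) {M : ℕ}
    (hM : 2 ^ M ≤ n) (hM' : n ≤ 2 ^ (M + 1)) (v : Fin d → ZMod n) :
    |cubeAverage (unroll ψ v) M - cubeAverage (unroll ψ 0) M| ≤
      2 * d * (((1 / 2) ^ (d - 1)) ^ M * ∑ x, gradSum ψ x) := by
  have hT : 0 ≤ ∑ x, gradSum ψ x := Finset.sum_nonneg fun x _ => gradSum_nonneg ψ x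
  have h := abs_torus_sub_le (fun w => ∑ a ∈ cube d (2 ^ M), unroll ψ w a) hT (fun x i => by
    rw [← Finset.sum_sub_distrib]
    calc |∑ a ∈ cube d (2 ^ M), (unroll ψ (x + Pi.single i 1) a - unroll ψ x a)|
        ≤ ∑ a ∈ cube d (2 ^ M), |unroll ψ (x + Pi.single i 1) a - unroll ψ x a| :=
          Finset.abs_sum_le_sum_abs _ _
      _ ≤ ∑ a ∈ cube d (2 ^ M), gradSum ψ (x + torusCast d n a) :=
          Finset.sum_le_sum fun a _ => by
            rw [unroll, unroll, add_right_comm]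
            exact abs_sub_le_gradSum ψ _ i
      _ = ∑ y ∈ torusCube n (2 ^ M) x, gradSum ψ y := sum_cube_eq_sum_torusCube hM x _
      _ ≤ _ := Finset.sum_le_sum_of_subset_of_nonneg (Finset.subset_univ _)
          fun y _ _ => gradSum_nonneg ψ y) v
  have hpos : (0 : ℝ) < ((2 ^ M) ^ d)⁻¹ := by positivity
  rw [cubeAverage, cubeAverage, ← mul_sub, abs_mul, abs_of_pos hpos]
  refine (mul_le_mul_of_nonneg_left h hpos.le).trans ?_
  have hn : (n : ℝ) ≤ 2 * 2 ^ M := by rw [← pow_succ']; exact_mod_cast hM'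
  have hpow : ((2 : ℝ) ^ M) ^ d = ((2 : ℝ) ^ (d - 1)) ^ M * 2 ^ M := by
    rw [← pow_mul, ← pow_mul, ← pow_add]
    congr 1
    obtain ⟨e, rfl⟩ : ∃ e, d = e + 1 := ⟨d - 1, by omega⟩
    rw [Nat.add_sub_cancel]; ring
  rw [hpow, one_div, inv_pow, inv_pow]
  calc (((2 : ℝ) ^ (d - 1)) ^ M * 2 ^ M)⁻¹ * (d * n * ∑ x, gradSum ψ x)
      ≤ (((2 : ℝ) ^ (d - 1)) ^ M * 2 ^ M)⁻¹ * (d * (2 * 2 ^ M) * ∑ x, gradSum ψ x) := by gcongr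
    _ = _ := by field_simp

/-- The difference of two values of a function on the torus is controlled by sums of its gradient
over dyadic cubes, of sides up to the size of the torus, around the two points. -/
theorem exists_abs_sub_le_multiscale (hd : 1 ≤ d) (ψ : (Fin d → ZMod n) → ℝ)
    (v : Fin d → ZMod n) :
    ∃ (M : ℕ) (B : ℕ → Finset (Fin d → ZMod n)),
      (∀ k ≤ M, ((B k).card : ℝ) ≤ 2 ^ d * (2 ^ d) ^ k) ∧
      |ψ v - ψ 0| ≤ 4 * d * 2 ^ d * ∑ k ∈ Finset.range (M + 1),
        ((1 / 2) ^ (d - 1)) ^ k * ∑ x ∈ B k, gradSum ψ x := by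
  classical
  set M := Nat.log 2 n with hMdef
  have hM : 2 ^ M ≤ n := Nat.pow_log_le_self 2 (NeZero.ne n)
  have hM' : n ≤ 2 ^ (M + 1) := (Nat.lt_pow_succ_log_self one_lt_two n).le
  -- The last scale takes the whole torus, to pay for comparing the two top averages. Its
  -- cardinality `n ^ d ≤ (2 * 2 ^ M) ^ d` accounts for the factor `2 ^ d` in the bound.
  set B : ℕ → Finset (Fin d → ZMod n) := fun k =>
    if k < M then torusCube n (2 ^ k) v ∪ torusCube n (2 ^ k) 0 else Finset.univ with hB
  have h0 := gradSum_nonneg ψ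
  refine ⟨M, B, fun k hk => ?_, ?_⟩
  · have htwo : 2 ≤ 2 ^ d := by
      calc 2 = 2 ^ 1 := rfl
        _ ≤ 2 ^ d := Nat.pow_le_pow_right two_pos hd
    have : (B k).card ≤ 2 ^ d * (2 ^ d) ^ k := by
      rw [pow_right_comm]
      rcases hk.lt_or_eq with h | h
      · rw [hB]
        simp only [if_pos h]
        calc _ ≤ (2 ^ k) ^ d + (2 ^ k) ^ d := (Finset.card_union_le _ _).trans
              (add_le_add (card_torusCube_le _ _) (card_torusCube_le _ _))
          _ = 2 * (2 ^ k) ^ d := (two_mul _).symm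
          _ ≤ _ := Nat.mul_le_mul_right _ htwo
      · rw [hB]
        simp only [if_neg (not_lt.2 h.ge)]
        rw [Finset.card_univ, Fintype.card_fun, ZMod.card, Fintype.card_fin, h, ← mul_pow,
          ← pow_succ']
        exact Nat.pow_le_pow_left hM' d
    exact_mod_cast this
  · set S := ∑ k ∈ Finset.range (M + 1), ((1 / 2 : ℝ) ^ (d - 1)) ^ k * ∑ x ∈ B k, gradSum ψ x
      with hS
    have hcube : ∀ w, w = v ∨ w = 0 → ∑ k ∈ Finset.range (M + 1), ((1 / 2 : ℝ) ^ (d - 1)) ^ k *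
        ∑ x ∈ torusCube n (2 ^ k) w, gradSum ψ x ≤ S := by
      intro w hw
      refine Finset.sum_le_sum fun k _ => mul_le_mul_of_nonneg_left ?_ (by positivity)
      refine Finset.sum_le_sum_of_subset_of_nonneg ?_ fun x _ _ => h0 x
      simp only [hB]
      split_ifs
      · rcases hw with rfl | rfl
        · exact Finset.subset_union_left
        · exact Finset.subset_union_right
      · exact Finset.subset_univ _
    have hlast : ((1 / 2 : ℝ) ^ (d - 1)) ^ M * ∑ x, gradSum ψ x ≤ S := by
      have hBM : B M = Finset.univ := if_neg (lt_irrefl M)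
      rw [← hBM]
      exact Finset.single_le_sum
        (f := fun k => ((1 / 2 : ℝ) ^ (d - 1)) ^ k * ∑ x ∈ B k, gradSum ψ x)
        (fun k _ => mul_nonneg (by positivity) (Finset.sum_nonneg fun x _ => h0 x))
        (Finset.mem_range.2 (Nat.lt_succ_self M))
    have hS0 : 0 ≤ S := Finset.sum_nonneg fun k _ =>
      mul_nonneg (by positivity) (Finset.sum_nonneg fun x _ => h0 x)
    have h1 := (abs_cubeAverage_unroll_le hd ψ hM v).trans
      (mul_le_mul_of_nonneg_left (hcube v (Or.inl rfl)) (by positivity))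
    have h2 := (abs_cubeAverage_unroll_le hd ψ hM 0).trans
      (mul_le_mul_of_nonneg_left (hcube 0 (Or.inr rfl)) (by positivity))
    have h3 := (abs_cubeAverage_unroll_sub_le hd ψ hM hM' v).trans
      (mul_le_mul_of_nonneg_left hlast (by positivity))
    have htri : |ψ v - ψ 0| ≤ |cubeAverage (unroll ψ v) M - ψ v| +
        |cubeAverage (unroll ψ v) M - cubeAverage (unroll ψ 0) M| +
        |cubeAverage (unroll ψ 0) M - ψ 0| := by
      rw [abs_sub_comm _ (ψ v)]
      calc _ ≤ |ψ v - cubeAverage (unroll ψ 0) M| + |cubeAverage (unroll ψ 0) M - ψ 0| :=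
            abs_sub_le _ _ _
        _ ≤ _ := by gcongr; exact abs_sub_le _ _ _
    have hd2 : (d : ℝ) * S ≤ d * S * 2 ^ d :=
      le_mul_of_one_le_right (by positivity) (one_le_pow₀ one_le_two)
    nlinarith

/-- The energy of a function on the torus. -/
noncomputable def torusEnergy (p : ℝ) (ψ : (Fin d → ZMod n) → ℝ) : ℝ :=
  ∑ x, ∑ i, potential p (ψ (x + Pi.single i 1) - ψ x)

theorem potential_le_torusEnergy (p : ℝ) (ψ : (Fin d → ZMod n) → ℝ) (x : Fin d → ZMod n)
    (i : Fin d) : potential p (ψ (x + Pi.single i 1) - ψ x) ≤ torusEnergy p ψ := by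
  have h0 : ∀ y j, 0 ≤ potential p (ψ (y + Pi.single j 1) - ψ y) := fun y j =>
    potential_nonneg p _
  have hsum : ∀ {ι : Type} [Fintype ι] (f : ι → ℝ) (j : ι), (∀ k, 0 ≤ f k) → f j ≤ ∑ k, f k :=
    fun f j hf => Finset.single_le_sum (fun k _ => hf k) (Finset.mem_univ j)
  have h1 := hsum (fun j => potential p (ψ (x + Pi.single j 1) - ψ x)) i (h0 x)
  have h2 := hsum (fun y => ∑ j, potential p (ψ (y + Pi.single j 1) - ψ y)) x
    fun y => Finset.sum_nonneg fun j _ => h0 y j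
  exact h1.trans h2

/-- A crude coercivity bound, used only for finiteness of the partition function, so its dependence
on `n` is harmless. -/
theorem sq_le_torusEnergy (p : ℝ) (ψ : (Fin d → ZMod n) → ℝ) (h0 : ψ 0 = 0)
    (v : Fin d → ZMod n) : ψ v ^ 2 ≤ (d * n) ^ 2 * torusEnergy p ψ := by
  have hE : 0 ≤ torusEnergy p ψ := Finset.sum_nonneg fun _ _ => Finset.sum_nonneg fun _ _ =>
    potential_nonneg _ _
  have h := abs_torus_sub_le ψ (Real.sqrt_nonneg (torusEnergy p ψ)) (fun x i => by
    refine Real.le_sqrt_of_sq_le ?_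
    rw [sq_abs]
    exact (le_add_of_nonneg_left (Real.rpow_nonneg (abs_nonneg _) p)).trans
      (potential_le_torusEnergy p ψ x i)) v
  rw [h0, sub_zero] at h
  calc ψ v ^ 2 = |ψ v| ^ 2 := (sq_abs _).symm
    _ ≤ (d * n * √(torusEnergy p ψ)) ^ 2 := by gcongr
    _ = _ := by rw [mul_pow, Real.sq_sqrt hE]

theorem sum_gradSum_le_torusEnergy {p : ℝ} (hp : 2 < p) (hd : 1 ≤ d)
    (ψ : (Fin d → ZMod n) → ℝ) :
    ∑ x, (gradSum ψ x ^ p + gradSum ψ x ^ 2) ≤ (d : ℝ) ^ (p - 1) * torusEnergy p ψ := by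
  rw [torusEnergy, Finset.mul_sum]
  refine Finset.sum_le_sum fun x _ => ?_
  have h1 := Real.rpow_sum_le_const_mul_sum_rpow (Finset.univ : Finset (Fin d))
    (fun i => ψ (x + Pi.single i 1) - ψ x) (by linarith : 1 ≤ p)
  have h2 : gradSum ψ x ^ 2 ≤ d * ∑ i, (ψ (x + Pi.single i 1) - ψ x) ^ 2 := by
    have := sq_sum_le_card_mul_sum_sq (s := (Finset.univ : Finset (Fin d)))
      (f := fun i => |ψ (x + Pi.single i 1) - ψ x|)
    simpa [gradSum] using this
  rw [Finset.card_univ, Fintype.card_fin] at h1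
  have hd1 : (1 : ℝ) ≤ d := by exact_mod_cast hd
  have h3 : (d : ℝ) ≤ (d : ℝ) ^ (p - 1) := by
    calc (d : ℝ) = (d : ℝ) ^ (1 : ℝ) := (Real.rpow_one _).symm
      _ ≤ _ := Real.rpow_le_rpow_of_exponent_le hd1 (by linarith)
  have h4 : 0 ≤ ∑ i, (ψ (x + Pi.single i 1) - ψ x) ^ 2 := Finset.sum_nonneg fun _ _ => sq_nonneg _
  unfold potential
  rw [Finset.sum_add_distrib, mul_add]
  exact add_le_add h1 (h2.trans (mul_le_mul_of_nonneg_right h3 h4))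

end Torus

/-- A function on the torus that vanishes at the origin and has height `t` somewhere has energy at
least a constant multiple of the decay rate at `t`. -/
theorem exists_tailRate_le_torusEnergy {d : ℕ} (hd : 3 ≤ d) {p : ℝ} (hp : 2 < p) :
    ∃ c : ℝ, 0 < c ∧ ∀ (n : ℕ) [NeZero n] (ψ : (Fin d → ZMod n) → ℝ) (v : Fin d → ZMod n) (t : ℝ),
      2 < t → ψ 0 = 0 → t ≤ ψ v → c * tailRate d p t ≤ torusEnergy p ψ := by
  obtain ⟨c, hc, h⟩ := exists_tailRate_le_of_multiscale hd hp (κ := 4 * d * 2 ^ d)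
    (by have : 0 < d := by omega
        positivity)
  have hd0 : (0 : ℝ) < (d : ℝ) ^ (p - 1) :=
    Real.rpow_pos_of_pos (by exact_mod_cast (by omega : 0 < d)) _
  refine ⟨((d : ℝ) ^ (p - 1))⁻¹ * c, by positivity, fun n _ ψ v t ht h0 hv => ?_⟩
  obtain ⟨M, B, hB, hle⟩ := exists_abs_sub_le_multiscale (by omega) ψ v
  rw [mul_assoc, inv_mul_le_iff₀ hd0]
  refine (h _ (gradSum ψ) B M t (gradSum_nonneg ψ) (fun k hk => (hB k hk).trans ?_) ht ?_).trans
    (sum_gradSum_le_torusEnergy hp (by omega) ψ)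
  · gcongr
    refine le_mul_of_one_le_left (by positivity) ?_
    have : (3 : ℝ) ≤ d := by exact_mod_cast hd
    linarith
  · rw [h0, sub_zero] at hle
    exact hv.trans ((le_abs_self _).trans hle)

/-! ### Graphs embedded in the discrete torus -/

section Embedding

theorem potential_zero {p : ℝ} (hp : p ≠ 0) : potential p 0 = 0 := by
  simp [potential, Real.zero_rpow hp]

variable {V : Type*} {d n : ℕ}

/-- A graph `G` with boundary `V₀` that embeds in the discrete torus so that the extension by zero
of a function vanishing on `V₀` creates no new gradients and vanishes at the origin. -/
structure IsTorusEmbedding (G : SimpleGraph V) (V₀ : Set V) (ρ : V → Fin d → ZMod n) : Prop where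
  injective : Function.Injective ρ
  mem_of_eq_zero : ∀ v, ρ v = 0 → v ∈ V₀
  adj : ∀ v w i, ρ w = ρ v + Pi.single i 1 → G.Adj v w
  mem_of_add_notMem : ∀ v i, ρ v + Pi.single i 1 ∉ Set.range ρ → v ∈ V₀
  mem_of_notMem : ∀ w x i, ρ w = x + Pi.single i 1 → x ∉ Set.range ρ → w ∈ V₀

variable {G : SimpleGraph V} {V₀ : Set V} {ρ : V → Fin d → ZMod n}

namespace IsTorusEmbedding

theorem extend_zero_eq (hρ : IsTorusEmbedding G V₀ ρ) {φ : V → ℝ} (hφ : ∀ v ∈ V₀, φ v = 0) :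
    Function.extend ρ φ 0 0 = 0 := by
  by_cases h : ∃ v, ρ v = 0
  · obtain ⟨v, hv⟩ := h
    rw [← hv, hρ.injective.extend_apply]
    exact hφ v (hρ.mem_of_eq_zero v hv)
  · rw [Function.extend_apply' _ _ _ h, Pi.zero_apply]

/-- If an endpoint of a torus step lies outside the image, the other is outside too or comes from
`V₀`; the extension vanishes at both, so a nonzero gradient must come from an edge of `G`. -/
theorem exists_adj (hρ : IsTorusEmbedding G V₀ ρ) {φ : V → ℝ} (hφ : ∀ v ∈ V₀, φ v = 0)
    (x : Fin d → ZMod n) (i : Fin d)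
    (h : Function.extend ρ φ 0 (x + Pi.single i 1) ≠ Function.extend ρ φ 0 x) :
    ∃ v w, G.Adj v w ∧ ρ v = x ∧ ρ w = x + Pi.single i 1 := by
  by_cases hx : x ∈ Set.range ρ
  · obtain ⟨v, rfl⟩ := hx
    by_cases hy : ρ v + Pi.single i 1 ∈ Set.range ρ
    · obtain ⟨w, hw⟩ := hy
      exact ⟨v, w, hρ.adj v w i hw, rfl, hw⟩
    · refine absurd ?_ h
      rw [hρ.injective.extend_apply, Function.extend_apply' _ _ _ hy, Pi.zero_apply,
        hφ v (hρ.mem_of_add_notMem v i hy)]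
  · refine absurd ?_ h
    by_cases hy : x + Pi.single i 1 ∈ Set.range ρ
    · obtain ⟨w, hw⟩ := hy
      rw [← hw, hρ.injective.extend_apply, Function.extend_apply' _ _ _ hx, Pi.zero_apply,
        hφ w (hρ.mem_of_notMem w x i hw hx)]
    · rw [Function.extend_apply' _ _ _ hy, Function.extend_apply' _ _ _ hx]
      rfl

variable [Fintype V] [NeZero n]

-- Every torus step with nonzero gradient is charged to an edge of `G` having an endpoint over the
-- base point of the step. Two endpoints and `d` directions give the factor `2 * d`.
open Classical in
theorem torusEnergy_extend_le (hρ : IsTorusEmbedding G V₀ ρ) {p : ℝ} (hp : p ≠ 0) {φ : V → ℝ}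
    (hφ : ∀ v ∈ V₀, φ v = 0) :
    torusEnergy p (Function.extend ρ φ 0) ≤ 2 * d * energy G (potential p) φ := by
  set ψ := Function.extend ρ φ 0 with hψ
  set F : Sym2 V → ℝ := fun e => potential p (grad φ e) with hF
  have hF0 : ∀ e, 0 ≤ F e := fun e => potential_nonneg p _
  have hterm : ∀ x i, potential p (ψ (x + Pi.single i 1) - ψ x) ≤
      ∑ e ∈ G.edgeFinset, if ∃ v ∈ e, ρ v = x then F e else 0 := by
    intro x i
    have hnn : ∀ e ∈ G.edgeFinset, 0 ≤ if ∃ v ∈ e, ρ v = x then F e else 0 := fun e _ => by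
      split_ifs
      · exact hF0 e
      · exact le_rfl
    by_cases h : ψ (x + Pi.single i 1) = ψ x
    · rw [h, sub_self, potential_zero hp]
      exact Finset.sum_nonneg hnn
    · obtain ⟨v, w, hadj, rfl, hw⟩ := hρ.exists_adj hφ x i h
      have hmem : s(w, v) ∈ G.edgeFinset := by
        rw [SimpleGraph.mem_edgeFinset, SimpleGraph.mem_edgeSet]
        exact hadj.symm
      refine le_trans (le_of_eq ?_) (Finset.single_le_sum hnn hmem)
      rw [if_pos ⟨v, Sym2.mem_mk_right w v, rfl⟩, hF]
      simp only
      rw [potential_grad (potential_neg p), hψ, ← hw, hρ.injective.extend_apply,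
        hρ.injective.extend_apply]
  have hcount : ∀ e : Sym2 V, ((Finset.univ.filter fun x => ∃ v ∈ e, ρ v = x).card : ℝ) ≤ 2 := by
    intro e
    induction e using Sym2.ind with
    | _ a b =>
      have hsub : (Finset.univ.filter fun x => ∃ v ∈ s(a, b), ρ v = x) ⊆ {ρ a, ρ b} := by
        intro x hx
        obtain ⟨v, hv, rfl⟩ := (Finset.mem_filter.1 hx).2
        rcases Sym2.mem_iff.1 hv with rfl | rfl <;> simp
      exact_mod_cast (Finset.card_le_card hsub).trans Finset.card_le_two
  calc torusEnergy p ψ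
      ≤ ∑ x, ∑ _i : Fin d, ∑ e ∈ G.edgeFinset, if ∃ v ∈ e, ρ v = x then F e else 0 :=
        Finset.sum_le_sum fun x _ => Finset.sum_le_sum fun i _ => hterm x i
    _ = d * ∑ e ∈ G.edgeFinset, (Finset.univ.filter fun x => ∃ v ∈ e, ρ v = x).card * F e := by
        simp only [Finset.sum_const, Finset.card_univ, Fintype.card_fin, nsmul_eq_mul]
        rw [← Finset.mul_sum, Finset.sum_comm]
        congr 1
        refine Finset.sum_congr rfl fun e _ => ?_
        rw [← Finset.sum_filter, Finset.sum_const, nsmul_eq_mul]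
    _ ≤ d * ∑ e ∈ G.edgeFinset, 2 * F e := by
        gcongr with e _
        · exact hF0 e
        · exact hcount e
    _ = 2 * d * energy G (potential p) φ := by
        rw [← Finset.mul_sum, energy]
        ring

theorem partitionFunction_ne_top (hρ : IsTorusEmbedding G V₀ ρ) (hd : 0 < d) {p : ℝ}
    (hp : p ≠ 0) : partitionFunction G V₀ (fun _ => 0) (potential p) ≠ ⊤ := by
  have hn : (0 : ℝ) < n := by exact_mod_cast Nat.pos_of_ne_zero (NeZero.ne n)
  have hd' : (0 : ℝ) < d := by exact_mod_cast hd
  rcases isEmpty_or_nonempty V with hV | hV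
  · exact RandomSurface.partitionFunction_ne_top G V₀ one_pos fun φ _ => by
      rw [Finset.univ_eq_empty, Finset.sum_empty]
      exact Finset.sum_nonneg fun e _ => potential_nonneg p _
  have hV0 : (0 : ℝ) < Fintype.card V := by exact_mod_cast Fintype.card_pos
  refine RandomSurface.partitionFunction_ne_top G V₀
    (c := (Fintype.card V * ((d * n) ^ 2 * (2 * d)))⁻¹) (by positivity) fun φ hφ => ?_
  rw [← Finset.mul_sum, inv_mul_le_iff₀ (by positivity)]
  calc ∑ v, φ v ^ 2 ≤ ∑ _v : V, (d * n) ^ 2 * (2 * d * energy G (potential p) φ) := by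
        refine Finset.sum_le_sum fun v _ => ?_
        have h := sq_le_torusEnergy p _ (hρ.extend_zero_eq hφ) (ρ v)
        rw [hρ.injective.extend_apply] at h
        exact h.trans (mul_le_mul_of_nonneg_left (hρ.torusEnergy_extend_le hp hφ) (by positivity))
    _ = _ := by
        rw [Finset.sum_const, Finset.card_univ, nsmul_eq_mul]
        ring

theorem isProbabilityMeasure (hρ : IsTorusEmbedding G V₀ ρ) (hd : 0 < d) {p : ℝ}
    (hp : 0 < p) : IsProbabilityMeasure (surfaceMeasure G V₀ (fun _ => 0) (potential p)) :=
  isProbabilityMeasure_surfaceMeasure G V₀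
    (partitionFunction_ne_zero G V₀ (continuous_potential hp.le))
    (hρ.partitionFunction_ne_top hd hp.ne')

theorem surfaceMeasure_tail_le (hρ : IsTorusEmbedding G V₀ ρ) (hd : 0 < d) {p : ℝ} (hp : 2 < p)
    {t m : ℝ} (hm : ∀ (ψ : (Fin d → ZMod n) → ℝ) (x : Fin d → ZMod n), ψ 0 = 0 → t ≤ ψ x →
      m ≤ torusEnergy p ψ) (v : V) :
    surfaceMeasure G V₀ (fun _ => 0) (potential p) {φ | t < |φ v|} ≤
      ENNReal.ofReal (2 * Real.exp (-((2 * (d : ℝ))⁻¹ * m))) := by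
  have hp0 : 0 < p := by linarith
  have hd' : (0 : ℝ) < d := by exact_mod_cast hd
  refine RandomSurface.surfaceMeasure_tail_le G V₀ (continuous_potential hp0.le)
    (potential_neg p) (potential_midpoint_add_le hp.le)
    (partitionFunction_ne_zero G V₀ (continuous_potential hp0.le))
    (hρ.partitionFunction_ne_top hd hp0.ne') v fun φ hφ hv => ?_
  rw [inv_mul_le_iff₀ (by positivity)]
  refine (hm (Function.extend ρ φ 0) (ρ v) (hρ.extend_zero_eq hφ) ?_).trans
    (hρ.torusEnergy_extend_le hp0.ne' hφ)
  rwa [hρ.injective.extend_apply]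

end IsTorusEmbedding

end Embedding

/-! ### The torus and the box -/

section Examples

variable {d L : ℕ}

/-- The reduction modulo `2 * L` of a family of integers. -/
def castModTwoMul {s : Finset ℤ} (L : ℕ) (v : Fin d → s) : Fin d → ZMod (2 * L) :=
  fun i => ((v i : ℤ) : ZMod (2 * L))

theorem castModTwoMul_injective {s : Finset ℤ}
    (hs : ∀ a ∈ s, ∀ b ∈ s, a - b < 2 * (L : ℤ)) :
    Function.Injective (castModTwoMul (d := d) (s := s) L) := by
  intro v w h
  ext i
  have hi := ((ZMod.intCast_eq_intCast_iff_dvd_sub _ _ _).1 (congrFun h i))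
  have h1 := hs _ (v i).2 _ (w i).2
  have h2 := hs _ (w i).2 _ (v i).2
  have := Int.eq_zero_of_abs_lt_dvd hi (by push_cast; rw [abs_lt]; constructor <;> linarith)
  linarith

theorem surjective_castModTwoMul_torus (hL : 0 < L) :
    Function.Surjective
      (castModTwoMul (d := d) (s := Finset.Icc (-(L : ℤ) + 1) (L : ℤ)) L) := by
  have : NeZero (2 * L) := ⟨by omega⟩
  intro x
  refine ⟨fun i => ⟨(x i).valMinAbs, ?_⟩, ?_⟩
  · obtain ⟨h1, h2⟩ := Set.mem_Ioc.1 (x i).valMinAbs_mem_Ioc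
    push_cast at h1 h2
    rw [Finset.mem_Icc]
    constructor <;> linarith
  · ext i
    simp [castModTwoMul]

theorem isTorusEmbedding_torus [NeZero (2 * L)] (hL : 2 ≤ L) :
    IsTorusEmbedding (torus d L) (torusBoundary d L)
      (castModTwoMul (d := d) (s := Finset.Icc (-(L : ℤ) + 1) (L : ℤ)) L) where
  injective := castModTwoMul_injective fun a ha b hb => by
    rw [Finset.mem_Icc] at ha hb
    linarith
  mem_of_eq_zero v hv i := by
    have h := (ZMod.intCast_zmod_eq_zero_iff_dvd _ _).1 (congrFun hv i)
    have hi := Finset.mem_Icc.1 (v i).2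
    refine Int.eq_zero_of_abs_lt_dvd h ?_
    push_cast
    rw [abs_lt]
    constructor <;> linarith
  adj v w i h := by
    refine ⟨i, fun j hj => ?_, Or.inr ?_⟩
    · have hj' := congrFun h j
      rw [Pi.add_apply, Pi.single_eq_of_ne hj, add_zero] at hj'
      have h1 := Finset.mem_Icc.1 (v j).2
      have h2 := Finset.mem_Icc.1 (w j).2
      have := Int.eq_zero_of_abs_lt_dvd ((ZMod.intCast_eq_intCast_iff_dvd_sub _ _ _).1 hj') (by
        push_cast; rw [abs_lt]; constructor <;> linarith)
      ext
      linarith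
    · have hi := congrFun h i
      rw [Pi.add_apply, Pi.single_eq_same] at hi
      have h1 : (((w i : ℤ) - v i : ℤ) : ZMod (2 * L)) = ((1 : ℤ) : ZMod (2 * L)) := by
        simp only [castModTwoMul] at hi
        push_cast
        rw [hi]
        ring
      simpa using (ZMod.intCast_eq_intCast_iff _ _ _).1 h1
  mem_of_add_notMem v i h := absurd (surjective_castModTwoMul_torus (by omega) _) h
  mem_of_notMem w x i _ h := absurd (surjective_castModTwoMul_torus (by omega) _) h

theorem latticeGraph_adj (v w : Fin d → ℤ) :
    (latticeGraph d).Adj v w ↔ ∑ i, |v i - w i| = 1 := Iff.rfl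

theorem latticeGraph_adj_add_single (v : Fin d → ℤ) (i : Fin d) (a : ℤ) (ha : |a| = 1) :
    (latticeGraph d).Adj v (v + Pi.single i a) := by
  rw [latticeGraph_adj]
  have h : ∀ j, |v j - (v + Pi.single i a : Fin d → ℤ) j| = if j = i then 1 else 0 := by
    intro j
    by_cases hj : j = i
    · subst hj
      rw [if_pos rfl, Pi.add_apply, Pi.single_eq_same, sub_add_cancel_left, abs_neg, ha]
    · rw [if_neg hj, Pi.add_apply, Pi.single_eq_of_ne hj, add_zero, sub_self, abs_zero]
  simp only [h, Finset.sum_ite_eq', Finset.mem_univ, if_true]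

theorem mem_boxBoundary_of_eq_right (v : BoxVertex d L) (i : Fin d) (h : (v i : ℤ) = L) :
    v ∈ boxBoundary d L := by
  refine ⟨v.toLattice + Pi.single i 1, latticeGraph_adj_add_single _ i 1 (by simp), ?_⟩
  rintro ⟨w, hw⟩
  have hi := congrFun hw i
  have := Finset.mem_Icc.1 (w i).2
  simp only [BoxVertex.toLattice, Pi.add_apply, Pi.single_eq_same] at hi
  omega

theorem mem_boxBoundary_of_eq_left (v : BoxVertex d L) (i : Fin d) (h : (v i : ℤ) = 1) :
    v ∈ boxBoundary d L := by
  refine ⟨v.toLattice + Pi.single i (-1), latticeGraph_adj_add_single _ i (-1) (by simp), ?_⟩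
  rintro ⟨w, hw⟩
  have hi := congrFun hw i
  have := Finset.mem_Icc.1 (w i).2
  simp only [BoxVertex.toLattice, Pi.add_apply, Pi.single_eq_same] at hi
  omega

/-- Placing the box in a torus of twice its side leaves a gap: the origin is not in the image, no
two box vertices become neighbours by wrapping around, and steps leave the image only through faces
with a coordinate `1` or `L`. -/
theorem isTorusEmbedding_box [NeZero (2 * L)] (hd : 0 < d) (hL : 2 ≤ L) :
    IsTorusEmbedding (box d L) (boxBoundary d L)
      (castModTwoMul (d := d) (s := Finset.Icc (1 : ℤ) (L : ℤ)) L) where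
  injective := castModTwoMul_injective fun a ha b hb => by
    rw [Finset.mem_Icc] at ha hb
    linarith
  mem_of_eq_zero v hv := by
    have h := (ZMod.intCast_zmod_eq_zero_iff_dvd _ _).1 (congrFun hv ⟨0, hd⟩)
    have hi := Finset.mem_Icc.1 (v ⟨0, hd⟩).2
    have := Int.eq_zero_of_abs_lt_dvd h (by
      push_cast
      rw [abs_lt]
      constructor <;> linarith)
    omega
  adj v w i h := by
    have hw : BoxVertex.toLattice w = BoxVertex.toLattice v + Pi.single i 1 := by
      ext j
      have h1 := Finset.mem_Icc.1 (v j).2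
      have h2 := Finset.mem_Icc.1 (w j).2
      have hj := congrFun h j
      have hcast : (((w j : ℤ) : ℤ) : ZMod (2 * L)) =
          (((v j : ℤ) + (Pi.single i 1 : Fin d → ℤ) j : ℤ) : ZMod (2 * L)) := by
        rw [Int.cast_add]
        refine hj.trans ?_
        rw [Pi.add_apply]
        congr 1
        by_cases hij : j = i
        · subst hij; simp
        · simp [hij]
      have hs : (Pi.single i 1 : Fin d → ℤ) j = 0 ∨ (Pi.single i 1 : Fin d → ℤ) j = 1 := by
        by_cases hij : j = i
        · subst hij; simp
        · simp [hij]
      have := Int.eq_zero_of_abs_lt_dvd ((ZMod.intCast_eq_intCast_iff_dvd_sub _ _ _).1 hcast) (by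
        push_cast; rw [abs_lt]; rcases hs with hs | hs <;> rw [hs] <;> constructor <;> linarith)
      simp only [BoxVertex.toLattice, Pi.add_apply]
      linarith
    change (latticeGraph d).Adj (BoxVertex.toLattice v) (BoxVertex.toLattice w)
    rw [hw]
    exact latticeGraph_adj_add_single _ i 1 (by simp)
  mem_of_add_notMem v i h := by
    refine mem_boxBoundary_of_eq_right v i ?_
    by_contra hne
    have hi := Finset.mem_Icc.1 (v i).2
    refine h ⟨Function.update v i ⟨(v i : ℤ) + 1, ?_⟩, ?_⟩
    · rw [Finset.mem_Icc]
      omega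
    · ext j
      by_cases hij : j = i
      · subst hij; simp [castModTwoMul]
      · simp [castModTwoMul, hij]
  mem_of_notMem w x i hw h := by
    refine mem_boxBoundary_of_eq_left w i ?_
    by_contra hne
    have hi := Finset.mem_Icc.1 (w i).2
    refine h ⟨Function.update w i ⟨(w i : ℤ) - 1, ?_⟩, ?_⟩
    · rw [Finset.mem_Icc]
      omega
    · ext j
      have hj := congrFun hw j
      by_cases hij : j = i
      · subst hij
        simp only [castModTwoMul, Pi.add_apply, Pi.single_eq_same] at hj
        simp [castModTwoMul, hj]
      · simp only [castModTwoMul, Pi.add_apply, Pi.single_eq_of_ne hij, add_zero] at hj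
        simp [castModTwoMul, hij, hj]

end Examples

end RandomSurface

theorem theorem1p5 (d : ℕ) (hd : 3 ≤ d) (p : ℝ) (hp : 2 < p) :
    ∃ C c : ℝ, 0 < C ∧ 0 < c ∧ ∀ L : ℕ, 2 ≤ L →
      (IsProbabilityMeasure (RandomSurface.torusMeasure d L (RandomSurface.potential p)) ∧
        ∀ v : RandomSurface.TorusVertex d L, v ∉ RandomSurface.torusBoundary d L →
          ∀ t : ℝ, 2 < t →
            RandomSurface.torusMeasure d L (RandomSurface.potential p) {φ | t < |φ v|} ≤
              ENNReal.ofReal (C * Real.exp (-(c * RandomSurface.tailRate d p t)))) ∧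
      (IsProbabilityMeasure (RandomSurface.boxMeasure d L (RandomSurface.potential p)) ∧
        ∀ v : RandomSurface.BoxVertex d L, v ∉ RandomSurface.boxBoundary d L →
          ∀ t : ℝ, 2 < t →
            RandomSurface.boxMeasure d L (RandomSurface.potential p) {φ | t < |φ v|} ≤
              ENNReal.ofReal (C * Real.exp (-(c * RandomSurface.tailRate d p t)))) := by
  have hd0 : 0 < d := by omega
  have hp0 : 0 < p := by linarith
  obtain ⟨c, hc, hE⟩ := RandomSurface.exists_tailRate_le_torusEnergy hd hp
  -- The `2` counts the two signs of the height; `(2 * d)⁻¹` is the loss between torus energy and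
  -- graph energy.
  refine ⟨2, (2 * (d : ℝ))⁻¹ * c, two_pos, by positivity, fun L hL => ?_⟩
  have : NeZero (2 * L) := ⟨by omega⟩
  have hT := RandomSurface.isTorusEmbedding_torus (d := d) hL
  have hB := RandomSurface.isTorusEmbedding_box hd0 hL
  refine ⟨⟨hT.isProbabilityMeasure hd0 hp0, fun v _ t ht => ?_⟩,
    ⟨hB.isProbabilityMeasure hd0 hp0, fun v _ t ht => ?_⟩⟩
  · rw [mul_assoc]
    exact hT.surfaceMeasure_tail_le hd0 hp (fun ψ x h0 hx => hE _ ψ x t ht h0 hx) v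
  · rw [mul_assoc]
    exact hB.surfaceMeasure_tail_le hd0 hp (fun ψ x h0 hx => hE _ ψ x t ht h0 hx) v
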